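/- Let $K$ be a field. A Nakayama algebra over $K$ is a finite-dimensional $K$-algebra all of whose indecomposable projective left and right modules are uniserial, i.e. have a unique composition series. Modules are right modules. For a finite-dimensional $K$-algebra $A$ with Jacobson radical $J$, the Loewy length $L(A)$ is the least $k \ge 0$ with $J^k = 0$. Let $A$ be a nonzero Nakayama algebra over $K$, and let $n$ be the number of isomorphism classes of simple $A$-modules. 1. If $L(A) \ge 2n$, then there exists a finitely generated indecomposable $A$-module $M$ with $\operatorname{Ext}_A^i(M,M) \ne 0$ for all $i > 0$. 2. If $A$ has finite global dimension, then $L(A) \le 2n-1$. The bound in (2) is sharp: for every field $K$ and every integer $n \ge 1$ there is a Nakayama algebra over $K$ with exactly $n$ simple modules up to isomorphism, of finite global dimension, and with Loewy length equal to $2n-1$. -/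

import Mathlib

universe u v

open CategoryTheory

/- All notions below are stated for left modules over a ring `R`. Right modules over an algebra `A`
are left modules over the opposite ring `Aᵐᵒᵖ`. -/

/-- A module is uniserial if it has a unique composition series (from `0` to the whole module). -/
def HasUniqueCompositionSeries (R : Type u) (M : Type v) [Ring R] [AddCommGroup M] [Module R M] :
    Prop :=
  ∃! s : CompositionSeries (Submodule R M), RelSeries.head s = ⊥ ∧ RelSeries.last s = ⊤

/-- Every indecomposable projective left `R`-module is uniserial. -/
def IndecomposableProjectivesUniserial (R : Type u) [Ring R] : Prop :=
  ∀ P : ModuleCat.{u} R, Indecomposable P → Module.Projective R P → HasUniqueCompositionSeries R P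

/-- A Nakayama algebra over a field `K`: a finite dimensional `K`-algebra all of whose
indecomposable projective left and right modules are uniserial. -/
structure IsNakayamaAlgebra (K : Type v) (A : Type u) [Field K] [Ring A] [Algebra K A] : Prop where
  finiteDimensional : FiniteDimensional K A
  left : IndecomposableProjectivesUniserial A
  right : IndecomposableProjectivesUniserial Aᵐᵒᵖ

/-- The Loewy length of a module `M` over an Artinian ring `R` with Jacobson radical `J`: the least
`k` with `J ^ k M = 0`. -/
noncomputable def loewyLength (R : Type u) (M : Type v) [Ring R] [AddCommGroup M] [Module R M] :
    ℕ :=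
  sInf {k : ℕ | (Ring.jacobson R) ^ k • (⊤ : Submodule R M) = ⊥}

/-- Isomorphism of simple `R`-modules. -/
def simpleModuleSetoid (R : Type u) [Ring R] :
    Setoid {S : ModuleCat.{u} R // IsSimpleModule R S} where
  r S T := Nonempty (S.1 ≃ₗ[R] T.1)
  iseqv :=
    { refl := fun _ => ⟨LinearEquiv.refl R _⟩
      symm := fun ⟨e⟩ => ⟨e.symm⟩
      trans := fun ⟨e⟩ ⟨f⟩ => ⟨e.trans f⟩ }

/-- The number of isomorphism classes of simple `R`-modules (finite if `R` is Artinian). -/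
noncomputable def numSimples (R : Type u) [Ring R] : ℕ :=
  Nat.card (Quotient (simpleModuleSetoid R))

/-- The global dimension of `R` is finite: the projective dimensions of all `R`-modules are bounded
by a natural number. -/
def HasFiniteGlobalDimension (R : Type u) [Ring R] : Prop :=
  ∃ d : ℕ, ∀ M : ModuleCat.{u} R, HasProjectiveDimensionLE M d

/-! Let `c q` be the length of the indecomposable projective `P q` with top the simple `q`. Its
submodules are exactly the radical powers. The radical of `P q`, if nonzero, is uniserial, hence a
quotient of the projective cover `P (next q)` of its top. So `c (next q) ≥ c q - 1`, and the
submodule `rad^l (P q)`, for `l < c q`, is the quotient of `P (next^[l] q)` of length `c q - l`.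
Writing `V q l` for `P q / rad^l`, the syzygy of `V q l` is therefore `V (next^[l] q) (c q - l)`.

If `L(A) ≥ 2n`, some `P s` has length at least `2n`. Among `s, next s, …, next^[n] s` two classes
agree, which gives `x` and `p` with `next^[p] x = x` and `c x ≥ 2p`. The module is `M = V x p`.
Since `next^[p]` fixes the orbit of `x`, syzygies of `M` only take the forms `V y p` and `V y (c y -
p)` with `y` in that orbit. Each has a nonzero map to `M`, because every class in the orbit occurs
as a composition factor of `M`. The inequality `c x ≥ 2p` ensures both that these maps exist and
that no nonzero one extends to the projective containing the syzygy. So `Ext^1` from each such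
module to `M` is nonzero, and dimension shifting gives all degrees (`nontrivial_ext_self`). With
finite global dimension high Ext groups vanish, so the second assertion follows from the first.

For sharpness with `n = m + 1`, take upper triangular matrices of size `2m + 1` invariant under the
diagonal shift by `m + 1`. The column module is uniserial with submodules `F 0 < F 1 < … < F (2m +
1)`, and the projective covers of the simples are `F (m + 1), …, F (2m + 1)`. The radical of `F (y +
1)` is `F y`, again projective unless `y = m`, and `F m` is the column module modulo `F (m + 1)` via
the shift. Hence the global dimension is at most 2, while the Loewy length is `2m + 1 = 2n - 1`. -/

/-- A module is uniserial if any two of its submodules are comparable. -/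
def IsUniserial (R : Type*) (M : Type*) [Ring R] [AddCommGroup M] [Module R M] : Prop :=
  ∀ N₁ N₂ : Submodule R M, N₁ ≤ N₂ ∨ N₂ ≤ N₁

/-! ### Uniserial modules and chains of submodules -/

section Uniserial

variable {R : Type*} {M M' : Type*} [Ring R] [AddCommGroup M] [Module R M]
  [AddCommGroup M'] [Module R M']

theorem exists_compositionSeries_of_le [IsNoetherian R M] [IsArtinian R M]
    (b : Submodule R M) : ∀ a : Submodule R M, a ≤ b →
      ∃ s : CompositionSeries (Submodule R M), s.head = a ∧ s.last = b := by
  intro a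
  induction a using WellFoundedGT.induction with
  | ind a ih =>
    intro hab
    rcases hab.eq_or_lt with rfl | hlt
    · exact ⟨RelSeries.singleton _ a, rfl, rfl⟩
    · obtain ⟨c, hac, hcb⟩ := exists_covBy_le_of_lt hlt
      obtain ⟨s, hs, hs'⟩ := ih c hac.lt hcb
      refine ⟨s.cons a (by rw [hs]; exact hac), RelSeries.head_cons .., ?_⟩
      rw [RelSeries.last_cons, hs']

theorem exists_compositionSeries_mem [IsNoetherian R M] [IsArtinian R M]
    (N : Submodule R M) :
    ∃ s : CompositionSeries (Submodule R M), s.head = ⊥ ∧ s.last = ⊤ ∧ N ∈ s := by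
  obtain ⟨s, hs, hs'⟩ := exists_compositionSeries_of_le N ⊥ bot_le
  obtain ⟨t, ht, ht'⟩ := exists_compositionSeries_of_le ⊤ N le_top
  refine ⟨s.smash t (hs'.trans ht.symm), ?_, ?_, ?_⟩
  · rw [RelSeries.head_smash, hs]
  · rw [RelSeries.last_smash, ht']
  · refine ⟨(Fin.last s.length).castLE (by simp), ?_⟩
    exact (RelSeries.smash_castLE (hs'.trans ht.symm) _).trans hs'

/-- Every submodule occurs in some composition series, so uniqueness puts all submodules into one
chain. -/
theorem IsUniserial.of_hasUniqueCompositionSeries [IsNoetherian R M] [IsArtinian R M]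
    (h : HasUniqueCompositionSeries R M) : IsUniserial R M := by
  intro N₁ N₂
  obtain ⟨s, h1, h2, h3⟩ := exists_compositionSeries_mem N₁
  obtain ⟨t, h4, h5, h6⟩ := exists_compositionSeries_mem N₂
  have : s = t := h.unique ⟨h1, h2⟩ ⟨h4, h5⟩
  subst this
  exact CompositionSeries.total h3 h6

/-- If `N` were missing, every term of the series would lie below `N`: a covering step leaves no
room for `N` strictly between two consecutive terms. The last term then forces `N = ⊤`, which is in
the series. -/
theorem IsUniserial.mem_compositionSeries (h : IsUniserial R M)
    {s : CompositionSeries (Submodule R M)} (h0 : s.head = ⊥) (h1 : s.last = ⊤)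
    (N : Submodule R M) : N ∈ s := by
  by_contra hN
  have key : ∀ k : ℕ, ∀ hk : k < s.length + 1, s ⟨k, hk⟩ ≤ N := by
    intro k
    induction k with
    | zero => intro hk; exact (le_of_eq h0).trans bot_le
    | succ k ih =>
      intro hk
      rcases h (s ⟨k + 1, hk⟩) N with hle | hle
      · exact hle
      · have hcov : s ⟨k, by omega⟩ ⋖ s ⟨k + 1, hk⟩ := s.step ⟨k, by omega⟩
        rcases hcov.eq_or_eq (ih (by omega)) hle with e | e
        · exact (hN ⟨_, e.symm⟩).elim
        · exact e.ge
  have := key s.length (by omega)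
  exact hN ⟨Fin.last _, (le_antisymm this (le_top.trans_eq h1.symm))⟩

theorem IsUniserial.hasUniqueCompositionSeries [IsNoetherian R M] [IsArtinian R M]
    (h : IsUniserial R M) : HasUniqueCompositionSeries R M := by
  obtain ⟨s, h1, h2⟩ := exists_compositionSeries_of_le (⊤ : Submodule R M) ⊥ bot_le
  refine ⟨s, ⟨h1, h2⟩, fun t ht => CompositionSeries.ext fun x => ?_⟩
  simp only [h.mem_compositionSeries h1 h2, h.mem_compositionSeries ht.1 ht.2]

theorem IsUniserial.of_injective (h : IsUniserial R M) (f : M' →ₗ[R] M)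
    (hf : Function.Injective f) : IsUniserial R M' := fun N₁ N₂ =>
  (h (N₁.map f) (N₂.map f)).imp (Submodule.map_le_map_iff_of_injective hf _ _).1
    (Submodule.map_le_map_iff_of_injective hf _ _).1

theorem IsUniserial.of_surjective (h : IsUniserial R M) (f : M →ₗ[R] M')
    (hf : Function.Surjective f) : IsUniserial R M' := fun N₁ N₂ =>
  (h (N₁.comap f) (N₂.comap f)).imp (Submodule.comap_le_comap_iff_of_surjective hf).1
    (Submodule.comap_le_comap_iff_of_surjective hf).1

theorem IsUniserial.of_generators
    (h : ∀ v w : M, (∃ r : R, r • v = w) ∨ ∃ r : R, r • w = v) : IsUniserial R M := by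
  intro N₁ N₂
  by_contra! hc
  obtain ⟨v, hv, hv'⟩ := SetLike.not_le_iff_exists.1 hc.1
  obtain ⟨w, hw, hw'⟩ := SetLike.not_le_iff_exists.1 hc.2
  rcases h v w with ⟨r, hr⟩ | ⟨r, hr⟩
  · exact hw' (hr ▸ N₁.smul_mem r hv)
  · exact hv' (hr ▸ N₂.smul_mem r hw)

theorem IsUniserial.isSimpleModule [Nontrivial M] [IsSemisimpleModule R M]
    (h : IsUniserial R M) : IsSimpleModule R M := by
  rw [isSimpleModule_iff]
  refine { eq_bot_or_eq_top := fun N => ?_ }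
  obtain ⟨C, hC⟩ := exists_isCompl N
  rcases h N C with hle | hle
  · exact Or.inl (disjoint_self.1 (hC.disjoint.mono_right hle))
  · right
    have := hC.sup_eq_top
    rwa [sup_eq_left.2 hle] at this

theorem IsUniserial.indecomposable {R : Type u} [Ring R] {M : ModuleCat.{v} R}
    [Nontrivial M] (h : IsUniserial R M) : Indecomposable M := by
  refine ⟨fun hz => not_subsingleton M (ModuleCat.isZero_iff_subsingleton.1 hz), fun Y Z i => ?_⟩
  have e := (i ≪≫ ModuleCat.biprodIsoProd Y Z).toLinearEquiv
  have hu : IsUniserial R (Y × Z) := h.of_surjective e.toLinearMap e.surjective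
  rw [ModuleCat.isZero_iff_subsingleton, ModuleCat.isZero_iff_subsingleton]
  rcases hu (Submodule.prod ⊤ ⊥) (Submodule.prod ⊥ ⊤) with hle | hle
  · left
    refine ⟨fun a b => ?_⟩
    have ha := hle (show (a - b, (0 : Z)) ∈ _ from ⟨trivial, rfl⟩)
    simpa [sub_eq_zero] using ha
  · right
    refine ⟨fun a b => ?_⟩
    have ha := hle (show ((0 : Y), a - b) ∈ _ from ⟨rfl, trivial⟩)
    simpa [sub_eq_zero] using ha

end Uniserial

/-- The `k`-th term of the radical series of a module. -/
def radPow (R : Type*) (M : Type*) [Ring R] [AddCommGroup M] [Module R M] (k : ℕ) :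
    Submodule R M :=
  Ring.jacobson R ^ k • (⊤ : Submodule R M)

/-! ### The radical series -/

section RadicalSeries

variable {R : Type*} {M M' : Type*} [Ring R] [AddCommGroup M] [Module R M]
  [AddCommGroup M'] [Module R M']

theorem radPow_zero : radPow R M 0 = ⊤ := by
  rw [radPow, Submodule.pow_zero, Ideal.one_eq_top, Submodule.top_smul]

theorem jacobson_pow_smul_radPow (j k : ℕ) :
    Ring.jacobson R ^ j • radPow R M k = radPow R M (j + k) := by
  rw [radPow, radPow, Ideal.IsTwoSided.pow_add, Submodule.mul_smul]

theorem radPow_antitone : Antitone (radPow R M) := fun _ _ h =>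
  Submodule.smul_mono_left (Ideal.pow_le_pow_right h)

theorem map_jacobson_pow_smul (f : M →ₗ[R] M') (k : ℕ) :
    (radPow R M k).map f = Ring.jacobson R ^ k • LinearMap.range f := by
  rw [radPow, Submodule.map_smul'', Submodule.map_top]

theorem map_radPow_le (f : M →ₗ[R] M') (k : ℕ) : (radPow R M k).map f ≤ radPow R M' k := by
  rw [map_jacobson_pow_smul]
  exact smul_mono_right _ le_top

theorem map_radPow_of_surjective {f : M →ₗ[R] M'} (hf : Function.Surjective f) (k : ℕ) :
    (radPow R M k).map f = radPow R M' k := by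
  rw [map_jacobson_pow_smul, LinearMap.range_eq_top.2 hf, radPow]

theorem map_radPow_of_range_eq {f : M →ₗ[R] M'} {j : ℕ}
    (hf : LinearMap.range f = radPow R M' j) (k : ℕ) :
    (radPow R M k).map f = radPow R M' (k + j) := by
  rw [map_jacobson_pow_smul, hf, jacobson_pow_smul_radPow]

theorem radPow_quotient_eq_bot (k : ℕ) : radPow R (M ⧸ radPow R M k) k = ⊥ := by
  rw [← map_radPow_of_surjective (Submodule.mkQ_surjective _), Submodule.mkQ_map_self]

variable (R M) in
theorem exists_radPow_eq_bot [IsSemiprimaryRing R] : ∃ k, radPow R M k = ⊥ := by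
  obtain ⟨k, hk⟩ := IsSemiprimaryRing.isNilpotent (R := R)
  exact ⟨k, by rw [radPow, hk]; exact Submodule.bot_smul _⟩

/-- Nakayama's lemma for a nilpotent radical. -/
theorem eq_top_of_sup_radPow_one [IsSemiprimaryRing R] {N : Submodule R M}
    (h : N ⊔ radPow R M 1 = ⊤) : N = ⊤ := by
  have key : ∀ k, N ⊔ radPow R M k = ⊤ := by
    intro k
    induction k with
    | zero => rw [radPow_zero, sup_top_eq]
    | succ k ih =>
      rw [eq_top_iff, ← h]
      refine sup_le le_sup_left ?_
      rw [radPow, ← ih, Submodule.pow_one, Submodule.smul_sup]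
      refine sup_le (le_sup_of_le_left Submodule.smul_le_right) (le_sup_of_le_right ?_)
      have := jacobson_pow_smul_radPow (R := R) (M := M) 1 k
      rw [Submodule.pow_one, Nat.add_comm] at this
      exact this.le
  obtain ⟨k, hk⟩ := exists_radPow_eq_bot R M
  simpa [hk] using key k

theorem isSemisimpleModule_quotient_radPow_one [IsSemiprimaryRing R] :
    IsSemisimpleModule R (M ⧸ radPow R M 1) := by
  have h : Module.IsTorsionBySet R (M ⧸ radPow R M 1) (Ring.jacobson R) := by
    rw [Module.isTorsionBySet_quotient_iff]
    intro m r hr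
    rw [radPow, Submodule.pow_one]
    exact Submodule.smul_mem_smul hr trivial
  let _ := h.module
  exact (h.semilinearMap.isSemisimpleModule_iff_of_bijective Function.bijective_id).2 inferInstance

theorem radPow_one_eq_bot_of_isSimpleModule [IsSimpleModule R M] : radPow R M 1 = ⊥ := by
  rw [radPow, Submodule.pow_one, eq_bot_iff]
  refine (Ring.jacobson_smul_top_le R M).trans_eq (IsSimpleModule.jacobson_eq_bot R M)

theorem radPow_one_ne_top [IsSemiprimaryRing R] [Nontrivial M] : radPow R M 1 ≠ ⊤ := by
  intro h
  exact bot_ne_top (eq_top_of_sup_radPow_one (N := (⊥ : Submodule R M)) (by rw [h, sup_top_eq]))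

theorem IsUniserial.isSimpleModule_top [IsSemiprimaryRing R] [Nontrivial M]
    (h : IsUniserial R M) : IsSimpleModule R (M ⧸ radPow R M 1) := by
  have := isSemisimpleModule_quotient_radPow_one (R := R) (M := M)
  have : Nontrivial (M ⧸ radPow R M 1) := Submodule.Quotient.nontrivial_iff.2 radPow_one_ne_top
  exact (h.of_surjective _ (Submodule.mkQ_surjective _)).isSimpleModule

/-- The top is simple, so the image of `N` there is zero or everything; in the latter case
Nakayama's lemma gives `N = ⊤`. -/
theorem IsUniserial.le_radPow_one [IsSemiprimaryRing R] (h : IsUniserial R M)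
    {N : Submodule R M} (hN : N ≠ ⊤) : N ≤ radPow R M 1 := by
  have : Nontrivial M := by
    by_contra hM
    rw [not_nontrivial_iff_subsingleton] at hM
    exact hN (Subsingleton.elim _ _)
  have := h.isSimpleModule_top
  rcases eq_bot_or_eq_top (N.map (radPow R M 1).mkQ) with h0 | h0
  · rwa [← le_bot_iff, Submodule.map_le_iff_le_comap, Submodule.comap_bot,
      Submodule.ker_mkQ] at h0
  · refine (hN (eq_top_of_sup_radPow_one ?_)).elim
    have := congrArg (Submodule.comap (radPow R M 1).mkQ) h0
    rwa [Submodule.comap_map_mkQ, Submodule.comap_top, sup_comm] at this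

theorem IsUniserial.le_radPow_succ [IsSemiprimaryRing R] (h : IsUniserial R M)
    {N : Submodule R M} {k : ℕ} (hN : N < radPow R M k) : N ≤ radPow R M (k + 1) := by
  have hu : IsUniserial R (radPow R M k) :=
    h.of_injective (radPow R M k).subtype Subtype.val_injective
  have h1 := hu.le_radPow_one (N := N.comap (radPow R M k).subtype) (by
    intro he
    rw [Submodule.comap_subtype_eq_top] at he
    exact hN.not_ge he)
  have h2 := Submodule.map_mono (f := (radPow R M k).subtype) h1
  rw [map_radPow_of_range_eq (Submodule.range_subtype _), Submodule.map_comap_subtype,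
    inf_eq_right.2 hN.le, Nat.add_comm] at h2
  exact h2

/-- A submodule different from all radical powers would descend through the whole series, which
reaches zero, and zero is a radical power. -/
theorem IsUniserial.exists_eq_radPow [IsSemiprimaryRing R] (h : IsUniserial R M)
    (N : Submodule R M) : ∃ k, N = radPow R M k := by
  by_contra! hN
  have key : ∀ k, N ≤ radPow R M k := by
    intro k
    induction k with
    | zero => rw [radPow_zero]; exact le_top
    | succ k ih => exact h.le_radPow_succ (lt_of_le_of_ne ih (hN k))
  obtain ⟨k, hk⟩ := exists_radPow_eq_bot R M
  exact hN k (le_antisymm (key k) ((hk).le.trans bot_le))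

theorem radPow_succ_ne [IsSemiprimaryRing R] {k : ℕ} (hk : radPow R M k ≠ ⊥) :
    radPow R M (k + 1) ≠ radPow R M k := by
  intro h
  have key : ∀ j, radPow R M (j + k) = radPow R M k := by
    intro j
    induction j with
    | zero => rw [Nat.zero_add]
    | succ j ih =>
      have h1 := jacobson_pow_smul_radPow (R := R) (M := M) 1 (j + k)
      have h2 := jacobson_pow_smul_radPow (R := R) (M := M) 1 k
      rw [ih, h2, Nat.add_comm 1 k, h] at h1
      rw [h1, Nat.add_comm 1, Nat.add_right_comm]
  obtain ⟨j, hj⟩ := exists_radPow_eq_bot R M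
  apply hk
  rw [← key j, eq_bot_iff, ← hj]
  exact radPow_antitone (Nat.le_add_right _ _)

end RadicalSeries

/-! ### Projective covers of simple modules -/

theorem ENat.lt_add_of_ne_zero {a b : ℕ∞} (ha : a ≠ ⊤) (hb : b ≠ 0) : a < a + b := by
  rcases eq_or_ne b ⊤ with rfl | hb'
  · rw [add_top]; exact ha.lt_top
  · lift a to ℕ using ha
    lift b to ℕ using hb'
    norm_cast at *
    omega

section Covers

variable {R : Type u} [Ring R]

/-- Take a finitely generated projective of minimal length mapping onto `S`. If it splits as `Y ×
Z`, one summand already maps onto the simple module `S`, and minimality kills the other. -/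
theorem exists_indecomposable_projective_cover [IsArtinianRing R]
    (S : Type u) [AddCommGroup S] [Module R S] [IsSimpleModule R S] :
    ∃ P : ModuleCat.{u} R, Indecomposable P ∧ Module.Projective R P ∧ Module.Finite R P ∧
      ∃ f : P →ₗ[R] S, Function.Surjective f := by
  have := IsSimpleModule.nontrivial R S
  let T : Set (ModuleCat.{u} R) := {P | Module.Projective R P ∧ Module.Finite R P ∧
      ∃ f : P →ₗ[R] S, Function.Surjective f}
  have hT : T.Nonempty := by
    obtain ⟨x, hx⟩ := exists_ne (0 : S)
    refine ⟨ModuleCat.of R R, inferInstanceAs (Module.Projective R R),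
      inferInstanceAs (Module.Finite R R), LinearMap.toSpanSingleton R S x, ?_⟩
    exact IsSimpleModule.toSpanSingleton_surjective R hx
  obtain ⟨P, ⟨hP, hfin, f, hf⟩, hmin⟩ := WellFounded.has_min
    (InvImage.wf (fun P : ModuleCat.{u} R => Module.length R P) wellFounded_lt) T hT
  refine ⟨P, ⟨?_, ?_⟩, hP, hfin, f, hf⟩
  · intro hz
    have := ModuleCat.isZero_iff_subsingleton.1 hz
    have := hf.subsingleton
    exact not_nontrivial S inferInstance
  · intro Y Z i
    have e : P ≃ₗ[R] Y × Z := (i ≪≫ ModuleCat.biprodIsoProd Y Z).toLinearEquiv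
    have hprod : Module.Projective R (Y × Z) := Module.Projective.of_equiv e
    have hfinprod : Module.Finite R (Y × Z) := Module.Finite.equiv e
    have pY : Module.Projective R Y := Module.Projective.of_split (LinearMap.inl R Y Z)
      (LinearMap.fst R Y Z) (LinearMap.fst_comp_inl ..)
    have pZ : Module.Projective R Z := Module.Projective.of_split (LinearMap.inr R Y Z)
      (LinearMap.snd R Y Z) (LinearMap.snd_comp_inr ..)
    have fY : Module.Finite R Y := Module.Finite.of_surjective (LinearMap.fst R Y Z)
      LinearMap.fst_surjective
    have fZ : Module.Finite R Z := Module.Finite.of_surjective (LinearMap.snd R Y Z)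
      LinearMap.snd_surjective
    have hlen : Module.length R P = Module.length R Y + Module.length R Z := by
      rw [e.length_eq, Module.length_prod]
    have hY : Module.length R Y ≠ ⊤ := Module.length_ne_top_iff.2
      (isFiniteLength_iff_isNoetherian_isArtinian.2 ⟨inferInstance, inferInstance⟩)
    have hZ : Module.length R Z ≠ ⊤ := Module.length_ne_top_iff.2
      (isFiniteLength_iff_isNoetherian_isArtinian.2 ⟨inferInstance, inferInstance⟩)
    rw [ModuleCat.isZero_iff_subsingleton, ModuleCat.isZero_iff_subsingleton]
    let g : Y × Z →ₗ[R] S := f ∘ₗ e.symm.toLinearMap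
    have hg : g ≠ 0 := by
      intro h0
      obtain ⟨x, hx⟩ := exists_ne (0 : S)
      obtain ⟨p, rfl⟩ := hf x
      exact hx (by simpa [g] using LinearMap.congr_fun h0 (e p))
    rcases LinearMap.surjective_or_eq_zero (g ∘ₗ LinearMap.inl R Y Z) with hs | h0
    · right
      have h1 := hmin Y ⟨pY, fY, _, hs⟩
      change ¬ Module.length R Y < Module.length R P at h1
      rw [hlen] at h1
      by_contra hne
      rw [← Module.length_eq_zero_iff (R := R)] at hne
      exact h1 (ENat.lt_add_of_ne_zero hY hne)
    rcases LinearMap.surjective_or_eq_zero (g ∘ₗ LinearMap.inr R Y Z) with hs | h1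
    · left
      have h1 := hmin Z ⟨pZ, fZ, _, hs⟩
      change ¬ Module.length R Z < Module.length R P at h1
      rw [hlen, add_comm] at h1
      by_contra hne
      rw [← Module.length_eq_zero_iff (R := R)] at hne
      exact h1 (ENat.lt_add_of_ne_zero hZ hne)
    · exact (hg (LinearMap.prod_ext h0 h1)).elim

theorem IsUniserial.ker_eq_radPow_one [IsSemiprimaryRing R] {P S : Type*} [AddCommGroup P]
    [Module R P] [AddCommGroup S] [Module R S] [IsSimpleModule R S] (h : IsUniserial R P)
    {f : P →ₗ[R] S} (hf : Function.Surjective f) : LinearMap.ker f = radPow R P 1 := by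
  have := IsSimpleModule.nontrivial R S
  refine le_antisymm (h.le_radPow_one fun htop => ?_) ?_
  · obtain ⟨x, hx⟩ := exists_ne (0 : S)
    obtain ⟨p, rfl⟩ := hf x
    exact hx (LinearMap.mem_ker.1 (htop ▸ Submodule.mem_top))
  · rw [← Submodule.comap_bot, ← Submodule.map_le_iff_le_comap,
      ← radPow_one_eq_bot_of_isSimpleModule (R := R) (M := S)]
    exact map_radPow_le f 1

/-- If `P₁`, `P₂` are uniserial modules with a common nonzero quotient, then all simple quotients
of `P₁` and `P₂` are isomorphic. -/
theorem nonempty_equiv_of_common_quotient [IsSemiprimaryRing R]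
    {P₁ P₂ S₁ S₂ N : Type v} [AddCommGroup P₁] [Module R P₁] [AddCommGroup P₂] [Module R P₂]
    [AddCommGroup S₁] [Module R S₁] [AddCommGroup S₂] [Module R S₂] [AddCommGroup N] [Module R N]
    [IsSimpleModule R S₁] [IsSimpleModule R S₂] [Nontrivial N]
    (h₁ : IsUniserial R P₁) (h₂ : IsUniserial R P₂)
    {f₁ : P₁ →ₗ[R] S₁} (hf₁ : Function.Surjective f₁)
    {f₂ : P₂ →ₗ[R] S₂} (hf₂ : Function.Surjective f₂)
    {g₁ : P₁ →ₗ[R] N} (hg₁ : Function.Surjective g₁)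
    {g₂ : P₂ →ₗ[R] N} (hg₂ : Function.Surjective g₂) : Nonempty (S₁ ≃ₗ[R] S₂) := by
  have := (h₁.of_surjective g₁ hg₁).isSimpleModule_top
  have e : ∀ {P S : Type v} [AddCommGroup P] [Module R P] [AddCommGroup S] [Module R S]
      [IsSimpleModule R S] (_ : IsUniserial R P) (f : P →ₗ[R] S) (_ : Function.Surjective f)
      (g : P →ₗ[R] N) (_ : Function.Surjective g), Nonempty (S ≃ₗ[R] (N ⧸ radPow R N 1)) := by
    intro P S _ _ _ _ _ h f hf g hg
    let π := (radPow R N 1).mkQ ∘ₗ g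
    have hπ : Function.Surjective π := (Submodule.mkQ_surjective _).comp hg
    exact ⟨(f.quotKerEquivOfSurjective hf).symm ≪≫ₗ
      Submodule.quotEquivOfEq _ _ ((h.ker_eq_radPow_one hf).trans (h.ker_eq_radPow_one hπ).symm) ≪≫ₗ
      π.quotKerEquivOfSurjective hπ⟩
  obtain ⟨e₁⟩ := e h₁ f₁ hf₁ g₁ hg₁
  obtain ⟨e₂⟩ := e h₂ f₂ hf₂ g₂ hg₂
  exact ⟨e₁ ≪≫ₗ e₂.symm⟩

/-- A lift along the projection to the top of a module is surjective. -/
theorem exists_surjective_of_surjective_top [IsSemiprimaryRing R]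
    {P S N : Type v} [AddCommGroup P] [Module R P] [AddCommGroup S] [Module R S]
    [AddCommGroup N] [Module R N] [Module.Projective R P]
    {f : P →ₗ[R] S} (hf : Function.Surjective f) (e : S ≃ₗ[R] (N ⧸ radPow R N 1)) :
    ∃ g : P →ₗ[R] N, Function.Surjective g := by
  obtain ⟨g, hg⟩ := Module.projective_lifting_property (radPow R N 1).mkQ
    (e.toLinearMap ∘ₗ f) (Submodule.mkQ_surjective _)
  refine ⟨g, LinearMap.range_eq_top.1 (eq_top_of_sup_radPow_one ?_)⟩
  have h : (LinearMap.range g).map (radPow R N 1).mkQ = ⊤ := by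
    rw [← LinearMap.range_comp, hg, LinearMap.range_eq_top]
    exact e.surjective.comp hf
  have := congrArg (Submodule.comap (radPow R N 1).mkQ) h
  rwa [Submodule.comap_map_mkQ, Submodule.comap_top, sup_comm] at this

/-- Each simple module is a factor of a fixed composition series of `R`: a nonzero map `R → S` is
nonzero for the first time at some step, and the factor of that step is `S`. The step determines the
isomorphism class. -/
theorem finite_simples [IsArtinianRing R] : Finite (Quotient (simpleModuleSetoid R)) := by
  obtain ⟨s, hs, hs'⟩ := exists_compositionSeries_of_le (R := R) (⊤ : Submodule R R) ⊥ bot_le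
  let F : Fin s.length → Quotient (simpleModuleSetoid R) → Prop := fun i q =>
    ∀ T : {S : ModuleCat.{u} R // IsSimpleModule R S}, ⟦T⟧ = q →
      Nonempty ((s i.succ ⧸ (s i.castSucc).submoduleOf (s i.succ)) ≃ₗ[R] T.1)
  have hF : ∀ q, ∃ i, F i q := by
    intro q
    induction q using Quotient.inductionOn with
    | h S =>
    obtain ⟨S, hS⟩ := S
    have := IsSimpleModule.nontrivial R S
    obtain ⟨x, hx⟩ := exists_ne (0 : S)
    let f := LinearMap.toSpanSingleton R S x
    have hf : f 1 ≠ 0 := by simpa [f] using hx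
    obtain ⟨i, h1, h2⟩ : ∃ i : Fin s.length, s i.castSucc ≤ LinearMap.ker f ∧
        ¬ s i.succ ≤ LinearMap.ker f := by
      by_contra! hc
      have key : ∀ k : ℕ, ∀ hk : k < s.length + 1, s ⟨k, hk⟩ ≤ LinearMap.ker f := by
        intro k
        induction k with
        | zero => intro hk; exact (le_of_eq hs).trans bot_le
        | succ k ih => intro hk; exact hc ⟨k, by omega⟩ (ih (by omega))
      exact hf (key s.length (by omega) ((hs'.ge : ⊤ ≤ s (Fin.last _)) trivial))
    refine ⟨i, fun T hT => ?_⟩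
    obtain ⟨e⟩ : Nonempty (T.1 ≃ₗ[R] S) := Quotient.exact hT
    have hcov : s i.castSucc ⋖ s i.succ := s.step i
    let g : s i.succ →ₗ[R] S := f ∘ₗ (s i.succ).subtype
    have hg : g ≠ 0 := by
      intro h0
      exact h2 fun y hy => LinearMap.congr_fun h0 ⟨y, hy⟩
    have hgs : Function.Surjective g := (LinearMap.surjective_or_eq_zero g).resolve_right hg
    have hker : (s i.castSucc).submoduleOf (s i.succ) = LinearMap.ker g := by
      have hsim := (covBy_iff_quot_is_simple hcov.le).1 hcov
      have hco := isSimpleModule_iff_isCoatom.1 hsim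
      refine (hco.le_iff.1 fun y hy => h1 hy).resolve_left ?_ |>.symm
      exact fun h => hg (LinearMap.ker_eq_top.1 h)
    exact ⟨Submodule.quotEquivOfEq _ _ hker ≪≫ₗ g.quotKerEquivOfSurjective hgs ≪≫ₗ e.symm⟩
  choose i hi using hF
  refine Finite.of_injective i fun q₁ q₂ h => ?_
  induction q₁ using Quotient.inductionOn with
  | h S₁ =>
  induction q₂ using Quotient.inductionOn with
  | h S₂ =>
  obtain ⟨e₁⟩ := hi _ S₁ rfl
  obtain ⟨e₂⟩ := h ▸ hi _ S₂ rfl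
  exact Quotient.sound ⟨e₁.symm ≪≫ₗ e₂⟩

end Covers

/-! ### Dimension shifting for Ext -/

section Syzygies

variable {R : Type u} [Ring R]

theorem shortExact_moduleCatMk {X₁ X₂ X₃ : Type v} [AddCommGroup X₁] [AddCommGroup X₂]
    [AddCommGroup X₃] [Module R X₁] [Module R X₂] [Module R X₃] (f : X₁ →ₗ[R] X₂)
    (g : X₂ →ₗ[R] X₃) (hf : Function.Injective f) (hg : Function.Surjective g)
    (h : LinearMap.range f = LinearMap.ker g) :
    (ShortComplex.moduleCatMk f g (LinearMap.range_le_ker_iff.1 h.le)).ShortExact where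
  exact := (ShortComplex.moduleCat_exact_iff_range_eq_ker _).2 h
  mono_f := (ModuleCat.mono_iff_injective _).2 hf
  epi_g := (ModuleCat.epi_iff_surjective _).2 hg

/-- The connecting map is injective, because in positive degree Ext from the projective middle term
vanishes. -/
theorem nontrivial_ext_succ {S : ShortComplex (ModuleCat.{u} R)} (hS : S.ShortExact)
    [Projective S.X₂] (M : ModuleCat.{u} R) {i : ℕ} (hi : 0 < i)
    (h : Nontrivial (Abelian.Ext S.X₁ M i)) : Nontrivial (Abelian.Ext S.X₃ M (i + 1)) := by
  obtain ⟨e, he⟩ := exists_ne (0 : Abelian.Ext S.X₁ M i)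
  refine ⟨hS.extClass.comp e (Nat.add_comm 1 i), 0, fun h0 => he ?_⟩
  obtain ⟨x, rfl⟩ := Abelian.Ext.contravariant_sequence_exact₁ hS M e _ h0
  obtain ⟨j, rfl⟩ : ∃ j, i = j + 1 := ⟨i - 1, by omega⟩
  rw [Abelian.Ext.eq_zero_of_projective x, Abelian.Ext.comp_zero]

/-- The connecting map kills `g` only if `g` extends to the middle term, and then `g` is zero by
`h`. -/
theorem nontrivial_ext_one {S : ShortComplex (ModuleCat.{u} R)} (hS : S.ShortExact)
    {M : ModuleCat.{u} R} (g : S.X₁ ⟶ M) (hg : g ≠ 0) (h : ∀ φ : S.X₂ ⟶ M, S.f ≫ φ = 0) :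
    Nontrivial (Abelian.Ext S.X₃ M 1) := by
  refine ⟨hS.extClass.comp (Abelian.Ext.mk₀ g) (Nat.add_zero 1), 0, fun h0 => hg ?_⟩
  obtain ⟨x, hx⟩ := Abelian.Ext.contravariant_sequence_exact₁ hS M _ _ h0
  obtain ⟨φ, rfl⟩ := Abelian.Ext.homEquiv₀.symm.surjective x
  rw [Abelian.Ext.homEquiv₀_symm_apply, Abelian.Ext.mk₀_comp_mk₀, h φ] at hx
  exact Abelian.Ext.homEquiv₀.symm.injective hx.symm

end Syzygies

/-! ### The length of the radical series -/

section RadicalLength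

variable {R : Type*} [Ring R] [IsSemiprimaryRing R]
  {P P' M : Type*} [AddCommGroup P] [Module R P] [AddCommGroup P'] [Module R P']
  [AddCommGroup M] [Module R M]

variable (R P) in
/-- The least `k` such that the `k`-th radical power of the module vanishes. -/
noncomputable def radLength : ℕ := by
  classical exact Nat.find (exists_radPow_eq_bot R P)

theorem radPow_eq_bot_iff {k : ℕ} : radPow R P k = ⊥ ↔ radLength R P ≤ k := by
  classical
  refine ⟨fun h => Nat.find_min' (exists_radPow_eq_bot R P) h, fun h => ?_⟩
  exact eq_bot_iff.2 ((radPow_antitone h).trans (Nat.find_spec (exists_radPow_eq_bot R P)).le)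

theorem radPow_lt_radPow {j k : ℕ} (hjk : j < k) (hj : j < radLength R P) :
    radPow R P k < radPow R P j := by
  have h1 : radPow R P (j + 1) < radPow R P j :=
    lt_of_le_of_ne (radPow_antitone j.le_succ)
      (radPow_succ_ne (fun h => hj.not_ge (radPow_eq_bot_iff.1 h)))
  exact (radPow_antitone hjk).trans_lt h1

theorem radLength_le_add {f : P' →ₗ[R] P} {k : ℕ} (hf : LinearMap.range f = radPow R P k) :
    radLength R P ≤ radLength R P' + k := by
  rw [← radPow_eq_bot_iff, ← map_radPow_of_range_eq hf, radPow_eq_bot_iff.2 le_rfl,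
    Submodule.map_bot]

/-- The kernel is some radical power; since `f` sends `rad^i` onto `rad^(i + k)`, the exponent is
the least `i` with `rad^(i + k)` zero in `P`. -/
theorem IsUniserial.ker_eq_radPow {f : P' →ₗ[R] P} (h : IsUniserial R P') {k : ℕ}
    (hf : LinearMap.range f = radPow R P k) (hk : k ≤ radLength R P) :
    LinearMap.ker f = radPow R P' (radLength R P - k) := by
  obtain ⟨j, hj⟩ := h.exists_eq_radPow (LinearMap.ker f)
  have hmap : ∀ i, radPow R P' i ≤ LinearMap.ker f ↔ radLength R P - k ≤ i := by
    intro i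
    rw [LinearMap.le_ker_iff_map, map_radPow_of_range_eq hf, radPow_eq_bot_iff]
    omega
  refine le_antisymm ?_ ((hmap _).2 le_rfl)
  rw [hj]
  exact radPow_antitone ((hmap j).1 hj.ge)

end RadicalLength

/-! ### Uniserial projective covers indexed by the simple modules -/

/-- For a ring all of whose indecomposable projective modules are uniserial: a family of uniserial
projective modules, indexed by the isomorphism classes of simple modules, such that every
nonzero uniserial module is a quotient of exactly one member. -/
structure UniserialCovers (R : Type u) [Ring R] where
  P : Quotient (simpleModuleSetoid R) → ModuleCat.{u} R
  projective q : Module.Projective R (P q)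
  finite q : Module.Finite R (P q)
  uniserial q : IsUniserial R (P q)
  exists_cover (N : Type u) [AddCommGroup N] [Module R N] [Nontrivial N] :
    IsUniserial R N → ∃ q, ∃ f : P q →ₗ[R] N, Function.Surjective f
  exists_ne_zero (N : Type u) [AddCommGroup N] [Module R N] [Nontrivial N] :
    ∃ q, ∃ f : P q →ₗ[R] N, ¬ LinearMap.range f ≤ radPow R N 1
  unique {N : Type u} [AddCommGroup N] [Module R N] [Nontrivial N] {q q'} {f : P q →ₗ[R] N}
    {f' : P q' →ₗ[R] N} : Function.Surjective f → Function.Surjective f' → q = q'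

theorem exists_uniserialCovers {R : Type u} [Ring R] [IsArtinianRing R]
    (hR : IndecomposableProjectivesUniserial R) : Nonempty (UniserialCovers R) := by
  have h : ∀ q : Quotient (simpleModuleSetoid R), ∃ P : ModuleCat.{u} R,
      Module.Projective R P ∧ Module.Finite R P ∧ IsUniserial R P ∧
      ∃ f : P →ₗ[R] q.out.1, Function.Surjective f := by
    intro q
    have := q.out.2
    obtain ⟨P, hind, hproj, hfin, hf⟩ := exists_indecomposable_projective_cover (R := R) q.out.1
    exact ⟨P, hproj, hfin, .of_hasUniqueCompositionSeries (hR P hind hproj), hf⟩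
  choose P hproj hfin huni f hf using h
  have cls : ∀ (S : Type u) [AddCommGroup S] [Module R S] (hS : IsSimpleModule R S),
      ∃ q : Quotient (simpleModuleSetoid R), Nonempty (q.out.1 ≃ₗ[R] S) := by
    intro S _ _ hS
    exact ⟨⟦⟨ModuleCat.of R S, hS⟩⟧, Quotient.mk_out (s := simpleModuleSetoid R)
      ⟨ModuleCat.of R S, hS⟩⟩
  refine ⟨⟨P, hproj, hfin, huni, ?_, ?_, ?_⟩⟩
  · intro N _ _ _ hN
    obtain ⟨q, ⟨e⟩⟩ := cls (N ⧸ radPow R N 1) hN.isSimpleModule_top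
    have := hproj q
    exact ⟨q, exists_surjective_of_surjective_top (hf q) e⟩
  · intro N _ _ _
    have := isSemisimpleModule_quotient_radPow_one (R := R) (M := N)
    have : Nontrivial (N ⧸ radPow R N 1) := Submodule.Quotient.nontrivial_iff.2 radPow_one_ne_top
    obtain ⟨S, hS⟩ := IsSemisimpleModule.exists_simple_submodule R (N ⧸ radPow R N 1)
    obtain ⟨q, ⟨e⟩⟩ := cls S hS
    have := hproj q
    obtain ⟨g, hg⟩ := Module.projective_lifting_property (radPow R N 1).mkQ
      (S.subtype ∘ₗ e.toLinearMap ∘ₗ f q) (Submodule.mkQ_surjective _)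
    refine ⟨q, g, fun hle => ?_⟩
    have := IsSimpleModule.nontrivial R S
    obtain ⟨x, hx⟩ := exists_ne (0 : S)
    obtain ⟨y, hy⟩ := e.surjective x
    obtain ⟨z, hz⟩ := hf q y
    have h1 : (radPow R N 1).mkQ (g z) = 0 := by
      rw [← LinearMap.mem_ker, Submodule.ker_mkQ]
      exact hle ⟨z, rfl⟩
    have h2 := LinearMap.congr_fun hg z
    simp only [LinearMap.comp_apply, h1, LinearEquiv.coe_coe, hz, hy] at h2
    exact hx (Subtype.ext h2.symm)
  · intro N _ _ _ q q' g g' hg hg'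
    have := q.out.2
    have := q'.out.2
    rw [← Quotient.out_eq q, ← Quotient.out_eq q']
    exact Quotient.sound
      (nonempty_equiv_of_common_quotient (huni q) (huni q') (hf q) (hf q') hg hg')

namespace UniserialCovers

variable {R : Type u} [Ring R] (C : UniserialCovers R)

/-- If the `k`-th radical power of all the modules `P q` vanishes, it vanishes for all modules. -/
theorem radPow_eq_bot (k : ℕ) (h : ∀ q, radPow R (C.P q) k = ⊥) (N : Type u) [AddCommGroup N]
    [Module R N] : radPow R N k = ⊥ := by
  -- `T` is the trace of the covers in `N`. If it were proper, a map from a cover to `N ⧸ T` with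
  -- image outside the radical would lift to `N`, so its image would lie in `T`, that is, be zero.
  let T : Submodule R N := ⨆ q, ⨆ f : C.P q →ₗ[R] N, LinearMap.range f
  have hT : T = ⊤ := by
    by_contra hne
    have : Nontrivial (N ⧸ T) := Submodule.Quotient.nontrivial_iff.2 hne
    obtain ⟨q, f, hf⟩ := C.exists_ne_zero (N ⧸ T)
    have := C.projective q
    obtain ⟨g, rfl⟩ := Module.projective_lifting_property T.mkQ f (Submodule.mkQ_surjective _)
    apply hf
    rintro _ ⟨x, rfl⟩
    have hx : g x ∈ T := by
      have h1 : LinearMap.range g ≤ T := le_iSup_of_le q (le_iSup_of_le g le_rfl)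
      exact h1 ⟨x, rfl⟩
    rw [LinearMap.comp_apply, Submodule.mkQ_apply, (Submodule.Quotient.mk_eq_zero T).2 hx]
    exact zero_mem _
  rw [radPow, ← hT, Submodule.smul_iSup]
  simp only [Submodule.smul_iSup, ← map_jacobson_pow_smul, h, Submodule.map_bot, iSup_bot]

theorem exists_next (q : Quotient (simpleModuleSetoid R)) :
    ∃ q', radPow R (C.P q) 1 ≠ ⊥ →
      ∃ f : C.P q' →ₗ[R] C.P q, LinearMap.range f = radPow R (C.P q) 1 := by
  by_cases h : radPow R (C.P q) 1 = ⊥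
  · exact ⟨q, fun h' => (h' h).elim⟩
  · have := Submodule.nontrivial_iff_ne_bot.2 h
    obtain ⟨q', f, hf⟩ := C.exists_cover (radPow R (C.P q) 1)
      ((C.uniserial q).of_injective _ (Submodule.injective_subtype _))
    refine ⟨q', fun _ => ⟨(Submodule.subtype _) ∘ₗ f, ?_⟩⟩
    rw [LinearMap.range_comp, LinearMap.range_eq_top.2 hf, Submodule.map_top,
      Submodule.range_subtype]

/-- The class of the top of the radical of `P q`. -/
noncomputable def next (q : Quotient (simpleModuleSetoid R)) : Quotient (simpleModuleSetoid R) :=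
  (C.exists_next q).choose

theorem exists_range_eq_radPow_one (q : Quotient (simpleModuleSetoid R))
    (h : radPow R (C.P q) 1 ≠ ⊥) :
    ∃ f : C.P (C.next q) →ₗ[R] C.P q, LinearMap.range f = radPow R (C.P q) 1 :=
  (C.exists_next q).choose_spec h

variable [IsArtinianRing R]

/-- Compose the maps `P (next q) → P q` along the orbit; the length drops by at most one each time,
so no radical met before step `k` is zero. -/
theorem exists_range_eq_radPow (k : ℕ) : ∀ q, k < radLength R (C.P q) →
    ∃ f : C.P (C.next^[k] q) →ₗ[R] C.P q, LinearMap.range f = radPow R (C.P q) k := by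
  induction k with
  | zero =>
    intro q _
    rw [Function.iterate_zero_apply]
    exact ⟨LinearMap.id, by rw [LinearMap.range_id, radPow_zero]⟩
  | succ k ih =>
    intro q hq
    obtain ⟨f, hf⟩ := C.exists_range_eq_radPow_one q
      (fun h => by rw [radPow_eq_bot_iff] at h; omega)
    obtain ⟨g, hg⟩ := ih (C.next q) (by have := radLength_le_add hf; omega)
    rw [Function.iterate_succ_apply]
    refine ⟨f ∘ₗ g, ?_⟩
    rw [LinearMap.range_comp, hg]
    exact map_radPow_of_range_eq hf k

theorem radLength_le_iterate (k : ℕ) (q : Quotient (simpleModuleSetoid R))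
    (h : k < radLength R (C.P q)) :
    radLength R (C.P q) ≤ radLength R (C.P (C.next^[k] q)) + k := by
  obtain ⟨f, hf⟩ := C.exists_range_eq_radPow k q h
  exact radLength_le_add hf

/-! ### Syzygies of uniserial modules and self-extensions -/

/-- The quotient of `P q` by its `l`-th radical power. -/
abbrev V (q : Quotient (simpleModuleSetoid R)) (l : ℕ) : ModuleCat.{u} R :=
  ModuleCat.of R (C.P q ⧸ radPow R (C.P q) l)

theorem exists_syzygy (q : Quotient (simpleModuleSetoid R)) (l : ℕ)
    (hl : l < radLength R (C.P q)) :
    ∃ f : C.V (C.next^[l] q) (radLength R (C.P q) - l) →ₗ[R] C.P q, Function.Injective f ∧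
      LinearMap.range f = radPow R (C.P q) l := by
  obtain ⟨f, hf⟩ := C.exists_range_eq_radPow l q hl
  have hker := (C.uniserial _).ker_eq_radPow hf hl.le
  refine ⟨(radPow R (C.P (C.next^[l] q)) (radLength R (C.P q) - l)).liftQ f hker.ge, ?_, ?_⟩
  · rw [← LinearMap.ker_eq_bot]
    exact Submodule.ker_liftQ_eq_bot _ _ _ hker.le
  · rw [Submodule.range_liftQ, hf]

theorem nontrivial_ext_V_succ (q : Quotient (simpleModuleSetoid R)) (l : ℕ)
    (hl : l < radLength R (C.P q)) (M : ModuleCat.{u} R) {i : ℕ} (hi : 0 < i)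
    (h : Nontrivial (Abelian.Ext (C.V (C.next^[l] q) (radLength R (C.P q) - l)) M i)) :
    Nontrivial (Abelian.Ext (C.V q l) M (i + 1)) := by
  obtain ⟨f, hf, hrange⟩ := C.exists_syzygy q l hl
  have hS := shortExact_moduleCatMk f (radPow R (C.P q) l).mkQ hf (Submodule.mkQ_surjective _)
    (hrange.trans (Submodule.ker_mkQ _).symm)
  have : Module.Projective R (C.P q) := C.projective q
  have : Projective (ShortComplex.moduleCatMk f (radPow R (C.P q) l).mkQ
    (LinearMap.range_le_ker_iff.1 (hrange.trans (Submodule.ker_mkQ _).symm).le)).X₂ :=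
    (IsProjective.iff_projective (C.P q)).1 this
  exact nontrivial_ext_succ hS M hi h

theorem nontrivial_ext_V_one (q : Quotient (simpleModuleSetoid R)) (l : ℕ)
    (hl : l < radLength R (C.P q)) (M : ModuleCat.{u} R)
    (g : C.V (C.next^[l] q) (radLength R (C.P q) - l) →ₗ[R] M) (hg : g ≠ 0)
    (h : ∀ φ : C.P q →ₗ[R] M, radPow R (C.P q) l ≤ LinearMap.ker φ) :
    Nontrivial (Abelian.Ext (C.V q l) M 1) := by
  obtain ⟨f, hf, hrange⟩ := C.exists_syzygy q l hl
  have hS := shortExact_moduleCatMk f (radPow R (C.P q) l).mkQ hf (Submodule.mkQ_surjective _)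
    (hrange.trans (Submodule.ker_mkQ _).symm)
  refine nontrivial_ext_one hS (ModuleCat.ofHom g) (fun h0 => hg (congrArg ModuleCat.Hom.hom h0))
    fun φ => ModuleCat.hom_ext (LinearMap.ext fun x => ?_)
  refine h φ.hom (?_ : f x ∈ radPow R (C.P q) l)
  rw [← hrange]
  exact LinearMap.mem_range_self f x

/-- The map `P (next^[t] x) → P x` with image `rad^t` stays nonzero in `V x p` as `t < p`, and it
kills `rad^k` because `k + t ≥ p`. -/
theorem exists_hom_V_ne_zero (x : Quotient (simpleModuleSetoid R)) {p t k : ℕ} (ht : t < p)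
    (hp : p ≤ radLength R (C.P x)) (hk : p ≤ k + t) :
    ∃ g : C.V (C.next^[t] x) k →ₗ[R] C.V x p, g ≠ 0 := by
  obtain ⟨f, hf⟩ := C.exists_range_eq_radPow t x (by omega)
  let f' := (radPow R (C.P x) p).mkQ ∘ₗ f
  have hf' : radPow R (C.P (C.next^[t] x)) k ≤ LinearMap.ker f' := by
    rw [LinearMap.ker_comp, Submodule.ker_mkQ, ← Submodule.map_le_iff_le_comap,
      map_radPow_of_range_eq hf]
    exact radPow_antitone hk
  refine ⟨(radPow R (C.P (C.next^[t] x)) k).liftQ f' hf', fun h0 => ?_⟩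
  have h1 : f' = 0 := by
    rw [← Submodule.liftQ_mkQ _ f' hf', h0, LinearMap.zero_comp]
  rw [← LinearMap.range_le_ker_iff, Submodule.ker_mkQ, hf] at h1
  exact (radPow_lt_radPow ht (by omega)).not_ge h1

/-- A nonzero `φ` has image `rad^a` of `V x p` with `a < p`. Comparing covers of this image gives `s
= next^[a] x`, so `P s` has length at least `2p - a`. Then `rad^(c s - p)` is sent into `rad^p` of
`V x p`, which is zero. -/
theorem radPow_le_ker (x s : Quotient (simpleModuleSetoid R)) {p : ℕ}
    (hx : 2 * p ≤ radLength R (C.P x)) (φ : C.P s →ₗ[R] C.V x p) :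
    radPow R (C.P s) (radLength R (C.P s) - p) ≤ LinearMap.ker φ := by
  by_cases h0 : LinearMap.range φ = ⊥
  · rw [LinearMap.range_eq_bot] at h0
    rw [h0, LinearMap.ker_zero]
    exact le_top
  have hu : IsUniserial R (C.V x p) :=
    (C.uniserial x).of_surjective _ (Submodule.mkQ_surjective (radPow R (C.P x) p))
  obtain ⟨a, ha⟩ := hu.exists_eq_radPow (LinearMap.range φ)
  have hap : a < p := by
    by_contra hle
    refine h0 (ha.trans (eq_bot_iff.2 ?_))
    exact (radPow_antitone (not_lt.1 hle)).trans (radPow_quotient_eq_bot p).le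
  obtain ⟨f, hf⟩ := C.exists_range_eq_radPow a x (by omega)
  let f' : C.P (C.next^[a] x) →ₗ[R] C.V x p := (radPow R (C.P x) p).mkQ ∘ₗ f
  have hf' : LinearMap.range f' = LinearMap.range φ := by
    rw [LinearMap.range_comp, hf, ha]
    exact map_radPow_of_surjective (Submodule.mkQ_surjective _) a
  have := Submodule.nontrivial_iff_ne_bot.2 h0
  have hs : s = C.next^[a] x := C.unique (f := φ.rangeRestrict)
    (f' := f'.codRestrict (LinearMap.range φ) (fun y => hf' ▸ LinearMap.mem_range_self f' y))
    φ.surjective_rangeRestrict (by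
      rw [← LinearMap.range_eq_top, LinearMap.range_codRestrict, hf',
        Submodule.comap_subtype_self])
  have hlen := C.radLength_le_iterate a x (by omega)
  rw [← hs] at hlen
  rw [LinearMap.le_ker_iff_map, map_radPow_of_range_eq ha, eq_bot_iff]
  exact (radPow_antitone (by omega)).trans (radPow_quotient_eq_bot p).le

/-- If `x` is periodic of period `p` under passing to the top of the radical, and `P x` has length
at least `2 p`, then all self-extension groups of `P x / rad^p` are nonzero. -/
theorem nontrivial_ext_self (x : Quotient (simpleModuleSetoid R)) {p : ℕ} (hp : 0 < p)
    (hper : C.next^[p] x = x) (hx : 2 * p ≤ radLength R (C.P x)) (i : ℕ) (hi : 0 < i) :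
    Nontrivial (Abelian.Ext (C.V x p) (C.V x p) i) := by
  have hmod : ∀ j, ∃ t < p, C.next^[j] x = C.next^[t] x := fun j =>
    ⟨j % p, Nat.mod_lt _ hp, (Function.IsPeriodicPt.iterate_mod_apply hper j).symm⟩
  -- With `t < p`, the length at `next^[t] x` is at least `2p - t > p`.
  have hlen : ∀ j, p < radLength R (C.P (C.next^[j] x)) := by
    intro j
    obtain ⟨t, ht, hj⟩ := hmod j
    have := C.radLength_le_iterate t x (by omega)
    rw [hj]
    omega
  have hnext : ∀ j l, C.next^[l] (C.next^[j] x) = C.next^[l + j] x := fun j l =>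
    (Function.iterate_add_apply _ _ _ _).symm
  have hnextp : ∀ j, C.next^[p] (C.next^[j] x) = C.next^[j] x := fun j => by
    rw [hnext, Nat.add_comm, Function.iterate_add_apply, hper]
  obtain ⟨i, rfl⟩ : ∃ k, i = k + 1 := ⟨i - 1, by omega⟩
  -- The two families are treated together because the syzygy of a member of either one lies in the
  -- other.
  suffices h : ∀ i j, Nontrivial (Abelian.Ext (C.V (C.next^[j] x) p) (C.V x p) (i + 1)) ∧
      Nontrivial (Abelian.Ext (C.V (C.next^[j] x) (radLength R (C.P (C.next^[j] x)) - p))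
        (C.V x p) (i + 1)) from (h i 0).1
  intro i
  induction i with
  | zero =>
    intro j
    have hj := hlen j
    constructor
    · obtain ⟨g, hg⟩ : ∃ g : C.V (C.next^[p] (C.next^[j] x))
          (radLength R (C.P (C.next^[j] x)) - p) →ₗ[R] C.V x p, g ≠ 0 := by
        obtain ⟨t, ht, hjt⟩ := hmod j
        have := C.radLength_le_iterate t x (by omega)
        rw [hnextp, hjt]
        exact C.exists_hom_V_ne_zero x ht (by omega) (by omega)
      refine C.nontrivial_ext_V_one _ _ hj _ g hg fun φ => ?_
      rw [LinearMap.le_ker_iff_map, eq_bot_iff]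
      exact (map_radPow_le φ p).trans (radPow_quotient_eq_bot p).le
    · obtain ⟨g, hg⟩ : ∃ g : C.V (C.next^[radLength R (C.P (C.next^[j] x)) - p] (C.next^[j] x))
          (radLength R (C.P (C.next^[j] x)) - (radLength R (C.P (C.next^[j] x)) - p)) →ₗ[R]
          C.V x p, g ≠ 0 := by
        rw [hnext, Nat.sub_sub_self hj.le]
        obtain ⟨t, ht, hjt⟩ := hmod (radLength R (C.P (C.next^[j] x)) - p + j)
        rw [hjt]
        exact C.exists_hom_V_ne_zero x ht (by omega) (by omega)
      exact C.nontrivial_ext_V_one _ _ (by omega) _ g hg (C.radPow_le_ker x _ hx)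
  | succ i ih =>
    intro j
    have hj := hlen j
    constructor
    · refine C.nontrivial_ext_V_succ _ _ hj _ (Nat.succ_pos _) ?_
      rw [hnextp]
      exact (ih j).2
    · refine C.nontrivial_ext_V_succ _ _ (by omega) _ (Nat.succ_pos _) ?_
      rw [hnext, Nat.sub_sub_self hj.le]
      exact (ih _).1

/-- A cover of length at least `2n` exists, since otherwise `rad^(2n - 1)` would vanish on `R`. The
pigeonhole principle on `n + 1` iterates gives `a < b ≤ n`, and `2n - a ≥ 2(b - a)`. -/
theorem exists_periodic (h : 2 * numSimples R ≤ radLength R R) [Nontrivial R] :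
    ∃ x p, 0 < p ∧ C.next^[p] x = x ∧ 2 * p ≤ radLength R (C.P x) := by
  have := finite_simples (R := R)
  have hne : Nonempty (Quotient (simpleModuleSetoid R)) := ⟨(C.exists_ne_zero R).choose⟩
  have hpos : 0 < numSimples R := Nat.card_pos
  obtain ⟨s, hs⟩ : ∃ s, 2 * numSimples R ≤ radLength R (C.P s) := by
    by_contra! hc
    have h1 := C.radPow_eq_bot (2 * numSimples R - 1)
      (fun q => radPow_eq_bot_iff.2 (Nat.le_sub_one_of_lt (hc q))) R
    rw [radPow_eq_bot_iff] at h1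
    omega
  obtain ⟨a, b, hab, heq⟩ : ∃ a b : Fin (numSimples R + 1), a < b ∧
      C.next^[a] s = C.next^[b] s := by
    have hni : ¬ Function.Injective fun a : Fin (numSimples R + 1) => C.next^[a] s := by
      intro hinj
      have := Nat.card_le_card_of_injective _ hinj
      rw [Nat.card_fin] at this
      exact absurd this (Nat.not_succ_le_self _)
    simp only [Function.Injective, not_forall] at hni
    obtain ⟨a, b, h1, h2⟩ := hni
    rcases lt_or_gt_of_ne h2 with h3 | h3
    · exact ⟨a, b, h3, h1⟩
    · exact ⟨b, a, h3, h1.symm⟩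
  have ha := a.2
  have hb := b.2
  have hab' : (a : ℕ) < b := hab
  refine ⟨C.next^[a] s, b - a, by omega, ?_, ?_⟩
  · rw [← Function.iterate_add_apply, Nat.sub_add_cancel hab'.le, heq]
  · have := C.radLength_le_iterate a s (by omega)
    omega

end UniserialCovers

theorem exists_nontrivial_ext_self {R : Type u} [Ring R] [IsArtinianRing R] [Nontrivial R]
    (hR : IndecomposableProjectivesUniserial R) (h : 2 * numSimples R ≤ radLength R R) :
    ∃ M : ModuleCat.{u} R, Module.Finite R M ∧ Indecomposable M ∧
      ∀ i : ℕ, 0 < i → Nontrivial (Abelian.Ext M M i) := by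
  obtain ⟨C⟩ := exists_uniserialCovers hR
  obtain ⟨x, p, hp, hper, hx⟩ := C.exists_periodic h
  have := C.finite x
  refine ⟨C.V x p, Module.Finite.of_surjective _ (Submodule.mkQ_surjective (radPow R (C.P x) p)),
    ?_, C.nontrivial_ext_self x hp hper hx⟩
  have : Nontrivial (C.V x p) := Submodule.Quotient.nontrivial_iff.2 (by
    have := radPow_lt_radPow (R := R) (P := C.P x) hp (by omega)
    rw [radPow_zero] at this
    exact this.ne)
  exact ((C.uniserial x).of_surjective _
    (Submodule.mkQ_surjective (radPow R (C.P x) p))).indecomposable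

/-! ### Testing uniseriality and global dimension on simple modules -/

section Criteria

variable {R : Type u} [Ring R]

/-- If every simple module is a quotient of a member of a family of finitely generated uniserial
projective modules, then every indecomposable projective module is uniserial. -/
theorem indecomposableProjectivesUniserial_of_family [IsArtinianRing R] {ι : Type*}
    (F : ι → Type u) [∀ i, AddCommGroup (F i)] [∀ i, Module R (F i)]
    [∀ i, Module.Projective R (F i)] [∀ i, Module.Finite R (F i)] (hF : ∀ i, IsUniserial R (F i))
    (hS : ∀ (S : Type u) [AddCommGroup S] [Module R S] [IsSimpleModule R S],
      ∃ i, ∃ f : F i →ₗ[R] S, Function.Surjective f) :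
    IndecomposableProjectivesUniserial R := by
  intro P hind hproj
  have hP : Nontrivial P := by
    by_contra h
    rw [not_nontrivial_iff_subsingleton] at h
    exact hind.1 (ModuleCat.isZero_iff_subsingleton.2 h)
  have := isSemisimpleModule_quotient_radPow_one (R := R) (M := P)
  have : Nontrivial (P ⧸ radPow R P 1) := Submodule.Quotient.nontrivial_iff.2 radPow_one_ne_top
  obtain ⟨N, hN, -⟩ := (eq_top_or_exists_le_coatom
    (⊥ : Submodule R (P ⧸ radPow R P 1))).resolve_left bot_ne_top
  have hsimple : IsSimpleModule R ((P ⧸ radPow R P 1) ⧸ N) := isSimpleModule_iff_isCoatom.2 hN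
  have := IsSimpleModule.nontrivial R ((P ⧸ radPow R P 1) ⧸ N)
  let π := N.mkQ ∘ₗ (radPow R P 1).mkQ
  have hπ : Function.Surjective π := (Submodule.mkQ_surjective _).comp (Submodule.mkQ_surjective _)
  obtain ⟨i, f, hf⟩ := hS ((P ⧸ radPow R P 1) ⧸ N)
  obtain ⟨φ, hφ⟩ := Module.projective_lifting_property f π hf
  -- The range of `φ` is comparable with the kernel of `f`. It cannot lie inside, as `π` is nonzero;
  -- so it contains the kernel, and as it also maps onto the simple quotient it is everything.
  have hφs : Function.Surjective φ := by
    rcases hF i (LinearMap.range φ) (LinearMap.ker f) with hle | hle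
    · have h0 : π = 0 := by rw [← hφ]; exact LinearMap.range_le_ker_iff.1 hle
      obtain ⟨x, hx⟩ := exists_ne (0 : (P ⧸ radPow R P 1) ⧸ N)
      obtain ⟨p, rfl⟩ := hπ x
      exact (hx (by rw [h0, LinearMap.zero_apply])).elim
    · intro y
      obtain ⟨p, hp⟩ := hπ (f y)
      have hy : y - φ p ∈ LinearMap.ker f := by
        rw [LinearMap.mem_ker, map_sub, ← hp, ← hφ, LinearMap.comp_apply, sub_self]
      obtain ⟨p', hp'⟩ := hle hy
      exact ⟨p' + p, by rw [map_add, hp', sub_add_cancel]⟩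
  obtain ⟨σ, hσ⟩ := Module.projective_lifting_property φ LinearMap.id hφs
  have hσ' : ∀ y, φ (σ y) = y := fun y => LinearMap.congr_fun hσ y
  -- The splitting of `φ` exhibits `F i` as a direct summand of `P`, and indecomposability leaves
  -- only `F i`.
  let e : (F i × LinearMap.ker φ) ≃ₗ[R] P := LinearEquiv.ofBijective
    (σ.coprod (LinearMap.ker φ).subtype) (by
      constructor
      · rw [← LinearMap.ker_eq_bot, LinearMap.ker_eq_bot']
        rintro ⟨a, b⟩ hab
        rw [LinearMap.coprod_apply, Submodule.subtype_apply] at hab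
        have ha := congrArg φ hab
        rw [map_add, hσ', LinearMap.mem_ker.1 b.2, add_zero, map_zero] at ha
        rw [ha, map_zero, zero_add] at hab
        exact Prod.ext ha (Subtype.ext hab)
      · intro p
        refine ⟨(φ p, ⟨p - σ (φ p), ?_⟩), ?_⟩
        · rw [LinearMap.mem_ker, map_sub, hσ', sub_self]
        · rw [LinearMap.coprod_apply, Submodule.subtype_apply, add_sub_cancel])
  have hz := hind.2 (ModuleCat.of R (F i)) (ModuleCat.of R (LinearMap.ker φ))
    (e.symm.toModuleIso ≪≫ (ModuleCat.biprodIsoProd (ModuleCat.of R (F i))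
      (ModuleCat.of R (LinearMap.ker φ))).symm)
  rw [ModuleCat.isZero_iff_subsingleton, ModuleCat.isZero_iff_subsingleton] at hz
  have hker : LinearMap.ker φ = ⊥ := by
    rcases hz with hz | hz
    · have hz' : Subsingleton (F i) := hz
      have : Subsingleton ((P ⧸ radPow R P 1) ⧸ N) := hf.subsingleton
      exact (not_subsingleton _ this).elim
    · have hz' : Subsingleton (LinearMap.ker φ) := hz
      exact (Submodule.subsingleton_iff_eq_bot).1 hz'
  have hinj : Function.Injective φ := LinearMap.ker_eq_bot.1 hker
  have := isNoetherian_of_injective φ hinj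
  have := isArtinian_of_injective φ hinj
  exact ((hF i).of_injective φ hinj).hasUniqueCompositionSeries

theorem shortExact_dfinsupp {ι : Type u} {K F X : ι → Type u} [∀ i, AddCommGroup (K i)]
    [∀ i, Module R (K i)] [∀ i, AddCommGroup (F i)] [∀ i, Module R (F i)]
    [∀ i, AddCommGroup (X i)] [∀ i, Module R (X i)] (j : ∀ i, K i →ₗ[R] F i)
    (g : ∀ i, F i →ₗ[R] X i) (hj : ∀ i, Function.Injective (j i))
    (hg : ∀ i, Function.Surjective (g i))
    (h : ∀ i, LinearMap.range (j i) = LinearMap.ker (g i)) :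
    (ShortComplex.moduleCatMk (DFinsupp.mapRange.linearMap j) (DFinsupp.mapRange.linearMap g)
      (LinearMap.ext fun x => DFinsupp.ext fun i =>
        LinearMap.congr_fun (LinearMap.range_le_ker_iff.1 (h i).le) (x i))).ShortExact := by
  refine shortExact_moduleCatMk (DFinsupp.mapRange.linearMap j) (DFinsupp.mapRange.linearMap g)
    ((DFinsupp.mapRange_injective _ fun i => map_zero _).2 hj)
    ((DFinsupp.mapRange_surjective _ fun i => map_zero _).2 hg) ?_
  classical
  refine Submodule.ext fun x => ?_
  rw [LinearMap.mem_range, LinearMap.mem_ker]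
  constructor
  · rintro ⟨y, rfl⟩
    ext i
    exact (h i).le (LinearMap.mem_range_self _ (y i))
  · intro hx
    have hx' : ∀ i, ∃ y, j i y = x i := fun i =>
      LinearMap.mem_range.1 ((h i).ge (DFunLike.congr_fun hx i))
    choose y hy using hx'
    refine ⟨DFinsupp.mk x.support fun i => y i, ?_⟩
    ext i
    rw [DFinsupp.mapRange.linearMap_apply, DFinsupp.mapRange_apply, DFinsupp.mk_apply]
    split_ifs with hi
    · exact hy i
    · rw [map_zero]; exact (DFinsupp.notMem_support_iff.1 hi).symm

/-- Direct sums of projectives are projective and direct sums are exact, so the bound passes through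
first syzygies by induction on `d`. -/
theorem hasProjectiveDimensionLT_dfinsupp (d : ℕ) {ι : Type u} :
    ∀ (X : ι → Type u) [∀ i, AddCommGroup (X i)] [∀ i, Module R (X i)],
      (∀ i, HasProjectiveDimensionLT (ModuleCat.of R (X i)) (d + 1)) →
      HasProjectiveDimensionLT (ModuleCat.of R (Π₀ i, X i)) (d + 1) := by
  induction d with
  | zero =>
    intro X _ _ h
    have : ∀ i, Module.Projective R (X i) := fun i =>
      (IsProjective.iff_projective (X i)).2
        (projective_iff_hasProjectiveDimensionLT_one.2 (h i))
    exact projective_iff_hasProjectiveDimensionLT_one.1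
      ((IsProjective.iff_projective (Π₀ i, X i)).1 inferInstance)
  | succ d ih =>
    intro X _ _ h
    let g : ∀ i, (X i →₀ R) →ₗ[R] X i := fun i => Finsupp.linearCombination R id
    have hg : ∀ i, Function.Surjective (g i) := fun i => Finsupp.linearCombination_id_surjective R _
    have hK : ∀ i, HasProjectiveDimensionLT (ModuleCat.of R (LinearMap.ker (g i))) (d + 1) := by
      intro i
      have hS := LinearMap.shortExact_shortComplexKer (hg i)
      have hp : Projective (g i).shortComplexKer.X₂ :=
        (IsProjective.iff_projective (X i →₀ R)).1 inferInstance
      exact (hS.hasProjectiveDimensionLT_X₃_iff d hp).1 (h i)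
    have hS := shortExact_dfinsupp (K := fun i => LinearMap.ker (g i)) (F := fun i => X i →₀ R)
      (fun i => (LinearMap.ker (g i)).subtype) g (fun i => Subtype.val_injective) hg
      (fun i => Submodule.range_subtype (LinearMap.ker (g i)))
    refine (hS.hasProjectiveDimensionLT_X₃_iff d ?_).2 (ih _ hK)
    exact (IsProjective.iff_projective (Π₀ i, (X i →₀ R))).1 inferInstance

/-- Over a semiprimary ring, the projective dimensions of all modules are bounded by those of
the simple modules. -/
theorem hasProjectiveDimensionLT_of_simples [IsSemiprimaryRing R] (d : ℕ)
    (h : ∀ (S : Type u) [AddCommGroup S] [Module R S] [IsSimpleModule R S],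
      HasProjectiveDimensionLT (ModuleCat.of R S) (d + 1)) (M : ModuleCat.{u} R) :
    HasProjectiveDimensionLT M (d + 1) := by
  refine IsSemiprimaryRing.induction ℤ R M
    (P := fun M => HasProjectiveDimensionLT (ModuleCat.of R M) (d + 1)) ?_ ?_
  · intro M _ i₁ i₂ _ _ _
    obtain ⟨s, e, hs⟩ := IsSemisimpleModule.exists_linearEquiv_dfinsupp R M
    have := hasProjectiveDimensionLT_dfinsupp (R := R) d (fun i : s => i.1)
      (fun i => have := hs.2 i; h i.1)
    exact hasProjectiveDimensionLT_of_iso e.symm.toModuleIso (d + 1)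
  · intro M _ i₁ i₂ _ N h₁ h₂
    have hS := shortExact_moduleCatMk N.subtype N.mkQ Subtype.val_injective
      (Submodule.mkQ_surjective _) ((Submodule.range_subtype _).trans (Submodule.ker_mkQ _).symm)
    exact hS.hasProjectiveDimensionLT_X₂ (d + 1) h₁ h₂

end Criteria

/-! ### Cyclic modules of the form `Re` -/

section CyclicProjective

variable {R M : Type*} [Ring R] [AddCommGroup M] [Module R M] {x : M} {e : R}

theorem exists_linearMap_apply_eq_smul (hx : ∀ y, ∃ r : R, r • x = y)
    (h : ∀ r : R, r • x = 0 → r * e = 0) {S : Type*} [AddCommGroup S] [Module R S] (s : S) :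
    ∃ f : M →ₗ[R] S, f x = e • s := by
  let g := LinearMap.toSpanSingleton R M x
  let g' := LinearMap.toSpanSingleton R S (e • s)
  have hle : LinearMap.ker g ≤ LinearMap.ker g' := by
    intro r hr
    rw [LinearMap.mem_ker, LinearMap.toSpanSingleton_apply] at hr ⊢
    rw [← mul_smul, h r hr, zero_smul]
  refine ⟨(LinearMap.ker g).liftQ g' hle ∘ₗ (g.quotKerEquivOfSurjective hx).symm.toLinearMap, ?_⟩
  have h1 : (g.quotKerEquivOfSurjective hx).symm x = (LinearMap.ker g).mkQ 1 := by
    rw [LinearEquiv.symm_apply_eq]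
    exact (one_smul R x).symm
  rw [LinearMap.comp_apply, LinearEquiv.coe_coe, h1, Submodule.mkQ_apply, Submodule.liftQ_apply]
  exact one_smul R _

/-- The map `M → R` sending `x` to `e` is split by `1 ↦ x`, since `e • x = x`. -/
theorem projective_of_annihilator (hx : ∀ y, ∃ r : R, r • x = y)
    (h : ∀ r : R, r • x = 0 → r * e = 0) (he : e • x = x) : Module.Projective R M := by
  obtain ⟨f, hf⟩ := exists_linearMap_apply_eq_smul hx h (1 : R)
  refine Module.Projective.of_split f (LinearMap.toSpanSingleton R M x) (LinearMap.ext fun y => ?_)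
  obtain ⟨r, rfl⟩ := hx y
  rw [LinearMap.comp_apply, map_smul, hf, smul_eq_mul, smul_eq_mul, mul_one,
    LinearMap.toSpanSingleton_apply, mul_smul, he, LinearMap.id_apply]

end CyclicProjective

theorem Nat.eq_add_of_modEq {a b n : ℕ} (h : a ≡ b [MOD n]) (hab : a < b) (hb : b < a + 2 * n) :
    b = a + n := by
  obtain ⟨c, hc⟩ := (Nat.modEq_iff_dvd' hab.le).1 h
  rcases c with _ | _ | c
  · omega
  · omega
  · have : n * (c + 1 + 1) = n * c + 2 * n := by ring
    have := Nat.zero_le (n * c)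
    omega

/-! ### The extremal example: shift-invariant triangular matrices -/

section ShiftAlgebra

variable (K : Type v) [Field K] (m : ℕ)

/-- The algebra of upper triangular matrices of size `2 m + 1` whose entries are invariant under
the diagonal shift by `m + 1`. It is the path algebra of the cyclic quiver with `m + 1` vertices,
modulo the cycle at one of the vertices. -/
def shiftAlgebra : Subalgebra K (Matrix (Fin (2 * m + 1)) (Fin (2 * m + 1)) K) where
  carrier := {a | (∀ x y, y < x → a x y = 0) ∧ ∀ x y x' y' : Fin (2 * m + 1),
    (x' : ℕ) = x + (m + 1) → (y' : ℕ) = y + (m + 1) → a x' y' = a x y}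
  mul_mem' := by
    rintro a b ⟨ha, ha'⟩ ⟨hb, hb'⟩
    refine ⟨fun x y hxy => ?_, fun x y x' y' hx hy => ?_⟩
    · rw [Matrix.mul_apply]
      refine Finset.sum_eq_zero fun z _ => ?_
      rcases lt_or_ge z x with hz | hz
      · rw [ha x z hz, zero_mul]
      · rw [hb z y (hxy.trans_le hz), mul_zero]
    · rw [Matrix.mul_apply, Matrix.mul_apply]
      symm
      -- By triangularity only indices between the row and the column contribute, and these
      -- correspond under the shift without leaving the range.
      refine Finset.sum_bij_ne_zero (fun z _ hz => ⟨z + (m + 1), ?_⟩) ?_ ?_ ?_ ?_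
      · have hzy : z ≤ y := not_lt.1 fun h => hz (by rw [hb z y h, mul_zero])
        have := y'.2
        have : (z : ℕ) ≤ y := hzy
        omega
      · exact fun _ _ _ => Finset.mem_univ _
      · intro z _ _ z' _ _ h
        simpa [Fin.ext_iff] using h
      · intro z _ hz
        have hzx : x' ≤ z := not_lt.1 fun h => hz (by rw [ha x' z h, zero_mul])
        have hzx' : (x' : ℕ) ≤ z := hzx
        have h1 : (z : ℕ) = (z - (m + 1) : ℕ) + (m + 1) := by omega
        refine ⟨⟨z - (m + 1), by omega⟩, Finset.mem_univ _, ?_, Fin.ext h1.symm⟩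
        rw [← ha' x ⟨z - (m + 1), by omega⟩ x' z hx h1, ← hb' ⟨z - (m + 1), by omega⟩ y z y' h1 hy]
        exact hz
      · intro z _ _
        rw [ha' x z x' _ hx rfl, hb' z y _ y' rfl hy]
  add_mem' := by
    rintro a b ⟨ha, ha'⟩ ⟨hb, hb'⟩
    refine ⟨fun x y hxy => ?_, fun x y x' y' hx hy => ?_⟩
    · rw [Matrix.add_apply, ha x y hxy, hb x y hxy, add_zero]
    · rw [Matrix.add_apply, ha' x y x' y' hx hy, hb' x y x' y' hx hy, Matrix.add_apply]
  algebraMap_mem' := by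
    intro c
    refine ⟨fun x y hxy => ?_, fun x y x' y' hx hy => ?_⟩
    · rw [Matrix.algebraMap_matrix_apply, if_neg hxy.ne']
    · rw [Matrix.algebraMap_matrix_apply, Matrix.algebraMap_matrix_apply]
      congr 1
      rw [Fin.ext_iff, Fin.ext_iff, hx, hy, Nat.add_right_cancel_iff]

variable {K m}

/-- The matrix of the path from `x` to `y`. -/
def pathMatrix (x y : Fin (2 * m + 1)) : Matrix (Fin (2 * m + 1)) (Fin (2 * m + 1)) K :=
  Matrix.of fun a b => if (a : ℕ) ≡ x [MOD m + 1] ∧ (b : ℕ) + x = a + y then 1 else 0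

theorem pathMatrix_mem {x y : Fin (2 * m + 1)} (h : x ≤ y) :
    (pathMatrix x y : Matrix _ _ K) ∈ shiftAlgebra K m := by
  have h' : (x : ℕ) ≤ y := h
  refine ⟨fun a b hab => ?_, fun a b a' b' ha hb => ?_⟩
  · have : (b : ℕ) < a := hab
    rw [pathMatrix, Matrix.of_apply, if_neg (by omega)]
  · simp only [pathMatrix, Matrix.of_apply]
    refine if_congr (and_congr ?_ (by omega)) rfl rfl
    rw [ha, Nat.ModEq, Nat.add_mod_right, Nat.ModEq]

variable (K m) in
/-- An isomorphism of a ring with the algebra `shiftAlgebra K m`. -/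
structure ShiftModel (R : Type v) [Ring R] where
  ρ : R →+* Matrix (Fin (2 * m + 1)) (Fin (2 * m + 1)) K
  injective : Function.Injective ρ
  mem r : ρ r ∈ shiftAlgebra K m
  surj : ∀ a ∈ shiftAlgebra K m, ∃ r, ρ r = a

namespace ShiftModel

variable {R : Type v} [Ring R] (D : ShiftModel K m R)

/-- Column vectors, as a module over `R`. -/
@[nolint unusedArguments]
def Col (_ : ShiftModel K m R) : Type v := Fin (2 * m + 1) → K

instance : AddCommGroup D.Col := inferInstanceAs (AddCommGroup (Fin (2 * m + 1) → K))

instance : Module R D.Col := Module.compHom (Fin (2 * m + 1) → K) D.ρ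

theorem smul_apply (r : R) (v : D.Col) (x : Fin (2 * m + 1)) :
    (r • v) x = ∑ y, D.ρ r x y * v y := rfl

theorem add_apply (v w : D.Col) (x : Fin (2 * m + 1)) : (v + w) x = v x + w x := rfl

theorem sub_apply (v w : D.Col) (x : Fin (2 * m + 1)) : (v - w) x = v x - w x := rfl

/-- The submodule of vectors supported on the first `k` coordinates. -/
def F (k : ℕ) : Submodule R D.Col where
  carrier := {v | ∀ x : Fin (2 * m + 1), k ≤ x → v x = 0}
  add_mem' hv hw x hx := by rw [D.add_apply, hv x hx, hw x hx, add_zero]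
  zero_mem' x _ := rfl
  smul_mem' r v hv x hx := by
    rw [D.smul_apply]
    refine Finset.sum_eq_zero fun y _ => ?_
    rcases lt_or_ge y x with hy | hy
    · rw [(D.mem r).1 x y hy, zero_mul]
    · rw [hv y (hx.trans hy), mul_zero]

theorem mem_F {k : ℕ} {v : D.Col} : v ∈ D.F k ↔ ∀ x : Fin (2 * m + 1), k ≤ x → v x = 0 := Iff.rfl

theorem F_mono : Monotone D.F := fun _ _ h _ hv x hx => hv x (h.trans hx)

theorem F_zero : D.F 0 = ⊥ := eq_bot_iff.2 fun _ hv => funext fun x => hv x (Nat.zero_le _)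

theorem F_top : D.F (2 * m + 1) = ⊤ :=
  eq_top_iff.2 fun _ _ x hx => absurd x.2 (not_lt.2 hx)

theorem smul_apply_of_mem_F {y : Fin (2 * m + 1)} {v : D.Col} (hv : v ∈ D.F (y + 1)) (r : R) :
    (r • v) y = D.ρ r y y * v y := by
  rw [D.smul_apply]
  refine Finset.sum_eq_single y (fun z _ hz => ?_) (fun h => absurd (Finset.mem_univ _) h)
  rcases lt_or_gt_of_ne hz with h | h
  · rw [(D.mem r).1 y z h, zero_mul]
  · rw [hv z h, mul_zero]

/-- Elimination from the last coordinate down: a multiple of the path from `x` to `y` turns `v` into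
a vector with the same coordinate as `w` at `x` and zeros after it. Subtracting it from `w` lowers
the support. -/
theorem exists_smul_eq {y : Fin (2 * m + 1)} {v : D.Col} (hv : v ∈ D.F (y + 1)) (hy : v y ≠ 0)
    {w : D.Col} (hw : w ∈ D.F (y + 1)) : ∃ r : R, r • v = w := by
  suffices h : ∀ k : ℕ, k ≤ y + 1 → ∀ w ∈ D.F k, ∃ r : R, r • v = w from h _ le_rfl w hw
  intro k
  induction k with
  | zero =>
    intro _ w hw
    rw [F_zero, Submodule.mem_bot] at hw
    exact ⟨0, by rw [zero_smul, hw]⟩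
  | succ x ih =>
    intro hx w hw
    have hxy : (⟨x, by omega⟩ : Fin (2 * m + 1)) ≤ y := Nat.le_of_succ_le_succ hx
    obtain ⟨r, hr⟩ := D.surj ((w ⟨x, by omega⟩ / v y) • pathMatrix ⟨x, by omega⟩ y)
      ((shiftAlgebra K m).smul_mem (pathMatrix_mem hxy) _)
    have hlead : (r • v) ⟨x, by omega⟩ = w ⟨x, by omega⟩ := by
      rw [D.smul_apply, Finset.sum_eq_single y]
      · rw [hr, Matrix.smul_apply, pathMatrix, Matrix.of_apply, if_pos ⟨rfl, add_comm _ _⟩,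
          smul_eq_mul, mul_one, div_mul_cancel₀ _ hy]
      · intro z _ hz
        rw [hr, Matrix.smul_apply, pathMatrix, Matrix.of_apply, if_neg, smul_zero, zero_mul]
        rintro ⟨-, h⟩
        exact hz (Fin.ext (by simp only at h; omega))
      · exact fun h => absurd (Finset.mem_univ _) h
    have htail : ∀ a : Fin (2 * m + 1), x < a → (r • v) a = 0 := by
      intro a ha
      rw [D.smul_apply]
      refine Finset.sum_eq_zero fun z _ => ?_
      rcases lt_or_ge y z with hz | hz
      · rw [hv z hz, mul_zero]
      · have hz' : (z : ℕ) ≤ y := hz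
        rw [hr, Matrix.smul_apply, pathMatrix, Matrix.of_apply, if_neg, smul_zero, zero_mul]
        rintro ⟨-, h⟩
        simp only at h
        omega
    obtain ⟨s, hs⟩ := ih (by omega) (w - r • v) (by
      intro a ha
      rw [D.sub_apply]
      rcases ha.eq_or_lt with h | h
      · have ha' : a = ⟨x, by omega⟩ := Fin.ext h.symm
        rw [ha', hlead, sub_self]
      · rw [hw a h, htail a h, sub_zero])
    exact ⟨s + r, by rw [add_smul, hs, sub_add_cancel]⟩

theorem exists_leading (v : D.Col) (hv : v ≠ 0) :
    ∃ y : Fin (2 * m + 1), v y ≠ 0 ∧ v ∈ D.F (y + 1) := by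
  classical
  have hne : (Finset.univ.filter fun x => v x ≠ 0).Nonempty := by
    by_contra h
    rw [Finset.not_nonempty_iff_eq_empty, Finset.filter_eq_empty_iff] at h
    exact hv (funext fun x => not_not.1 (h (Finset.mem_univ x)))
  refine ⟨_, (Finset.mem_filter.1 (Finset.max'_mem _ hne)).2, fun x hx => ?_⟩
  by_contra h
  exact absurd (Finset.le_max' _ x (Finset.mem_filter.2 ⟨Finset.mem_univ x, h⟩))
    (not_le.2 hx)

theorem isUniserial_col : IsUniserial R D.Col := by
  refine IsUniserial.of_generators fun v w => ?_
  rcases eq_or_ne v 0 with rfl | hv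
  · exact Or.inr ⟨0, zero_smul _ _⟩
  rcases eq_or_ne w 0 with rfl | hw
  · exact Or.inl ⟨0, zero_smul _ _⟩
  obtain ⟨x, hx, hx'⟩ := D.exists_leading v hv
  obtain ⟨y, hy, hy'⟩ := D.exists_leading w hw
  rcases le_total x y with h | h
  · exact Or.inr (D.exists_smul_eq hy' hy (D.F_mono (Nat.succ_le_succ h) hx'))
  · exact Or.inl (D.exists_smul_eq hx' hx (D.F_mono (Nat.succ_le_succ h) hy'))

theorem isUniserial_F (k : ℕ) : IsUniserial R (D.F k) :=
  D.isUniserial_col.of_injective _ (Submodule.injective_subtype _)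

/-- The unit vector at `y`, a generator of `F (y + 1)`. -/
def single (y : Fin (2 * m + 1)) : D.F (y + 1) :=
  ⟨(Pi.single y 1 : Fin (2 * m + 1) → K), fun _ hx => Pi.single_eq_of_ne (by
    rintro rfl
    omega) _⟩

theorem single_apply_self (y : Fin (2 * m + 1)) : (D.single y).1 y = 1 := Pi.single_eq_same _ _

theorem exists_smul_single (y : Fin (2 * m + 1)) (v : D.F (y + 1)) :
    ∃ r : R, r • D.single y = v := by
  obtain ⟨r, hr⟩ := D.exists_smul_eq (D.single y).2
    (by rw [single_apply_self]; exact one_ne_zero) v.2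
  exact ⟨r, Subtype.ext hr⟩

instance (y : Fin (2 * m + 1)) : Module.Finite R (D.F (y + 1)) :=
  Module.Finite.of_surjective (LinearMap.toSpanSingleton R _ (D.single y)) (D.exists_smul_single y)

/-- The idempotent at the vertex `y`. -/
noncomputable def idem (y : Fin (2 * m + 1)) : R :=
  (D.surj _ (pathMatrix_mem (K := K) (le_refl y))).choose

theorem ρ_idem (y a b : Fin (2 * m + 1)) :
    D.ρ (D.idem y) a b = if (a : ℕ) ≡ y [MOD m + 1] ∧ b = a then 1 else 0 := by
  rw [idem, (D.surj _ (pathMatrix_mem (K := K) (le_refl y))).choose_spec, pathMatrix,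
    Matrix.of_apply]
  refine if_congr (and_congr Iff.rfl ?_) rfl rfl
  rw [Nat.add_right_cancel_iff, Fin.ext_iff]

theorem smul_single_apply (r : R) (x y : Fin (2 * m + 1)) :
    (r • D.single y).1 x = D.ρ r x y := by
  change (r • (D.single y).1) x = _
  rw [D.smul_apply, Finset.sum_eq_single y]
  · rw [single_apply_self, mul_one]
  · intro z _ hz
    rw [show (D.single y).1 z = 0 from
      Pi.single_eq_of_ne (M := fun _ : Fin (2 * m + 1) => K) hz _, mul_zero]
  · exact fun h => absurd (Finset.mem_univ _) h

theorem idem_smul_single (y : Fin (2 * m + 1)) : D.idem y • D.single y = D.single y := by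
  refine Subtype.ext (funext fun x => ?_)
  rw [smul_single_apply, ρ_idem]
  rcases eq_or_ne x y with rfl | h
  · rw [if_pos ⟨rfl, rfl⟩, single_apply_self]
  · rw [if_neg (fun h' => h h'.2.symm)]
    exact (Pi.single_eq_of_ne (M := fun _ : Fin (2 * m + 1) => K) h _).symm

/-- Right multiplication by the idempotent keeps the columns congruent to `y` modulo `m + 1`. As `y
≥ m`, the only such column besides `y` can be `y - (m + 1)`, and shift invariance makes its entries
on and above the diagonal reappear in column `y`. -/
theorem mul_idem_eq_zero {y : Fin (2 * m + 1)} (hy : m ≤ y) (r : R) (h : r • D.single y = 0) :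
    r * D.idem y = 0 := by
  have hcol : ∀ x, D.ρ r x y = 0 := fun x => by rw [← smul_single_apply, h]; rfl
  apply D.injective
  rw [map_mul, map_zero]
  ext a b
  rw [Matrix.mul_apply, Matrix.zero_apply]
  refine Finset.sum_eq_zero fun z _ => ?_
  rw [ρ_idem]
  split_ifs with hz
  · rw [mul_one]
    rcases eq_or_ne z y with rfl | hzy
    · exact hcol a
    rcases lt_or_ge z a with hza | hza
    · exact (D.mem r).1 a z hza
    have h1 := hz.1
    have hza' : (a : ℕ) ≤ z := hza
    have hzy' : (z : ℕ) ≠ y := fun h => hzy (Fin.ext h)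
    have hz2 := z.2
    have hy2 := y.2
    have h2 : (y : ℕ) = z + (m + 1) := by
      rcases Nat.lt_or_gt_of_ne hzy' with hlt | hgt
      · exact Nat.eq_add_of_modEq h1 hlt (by omega)
      · have := Nat.eq_add_of_modEq h1.symm hgt (by omega)
        omega
    have h3 := (D.mem r).2 a z ⟨a + (m + 1), by omega⟩ y rfl h2
    rw [← h3]
    exact hcol _
  · rw [mul_zero]

theorem projective_F {y : Fin (2 * m + 1)} (hy : m ≤ y) : Module.Projective R (D.F (y + 1)) :=
  projective_of_annihilator (D.exists_smul_single y) (D.mul_idem_eq_zero hy) (D.idem_smul_single y)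

end ShiftModel

end ShiftAlgebra

/-! ### Simple modules, Loewy length and global dimension of the example -/

namespace ShiftModel

variable {K : Type v} [Field K] {m : ℕ} {R : Type v} [Ring R] (D : ShiftModel K m R)

/-- The vertices `m, …, 2 m`, which index the indecomposable projective modules. -/
def vertex (i : Fin (m + 1)) : Fin (2 * m + 1) := ⟨m + i, by omega⟩

theorem le_vertex (i : Fin (m + 1)) : m ≤ (vertex i : Fin (2 * m + 1)) := Nat.le_add_right _ _

/-- The vertices `m, …, 2m` represent each residue modulo `m + 1` exactly once, so each diagonal
position is hit by one idempotent. -/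
theorem sum_idem : ∑ i : Fin (m + 1), D.idem (vertex i) = 1 := by
  apply D.injective
  rw [map_sum, map_one]
  ext a b
  rw [Matrix.sum_apply]
  simp only [ρ_idem]
  rcases eq_or_ne b a with rfl | hab
  · rw [Matrix.one_apply_eq]
    have hb := b.2
    obtain ⟨i, hi⟩ : ∃ i : Fin (m + 1), (b : ℕ) ≡ (vertex i : Fin (2 * m + 1)) [MOD m + 1] := by
      rcases lt_or_ge (b : ℕ) m with h | h
      · refine ⟨⟨b + 1, by omega⟩, ?_⟩
        change (b : ℕ) ≡ m + (b + 1) [MOD m + 1]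
        rw [show m + ((b : ℕ) + 1) = b + (m + 1) by omega, Nat.ModEq, Nat.add_mod_right]
      · refine ⟨⟨b - m, by omega⟩, ?_⟩
        change (b : ℕ) ≡ m + (b - m) [MOD m + 1]
        rw [Nat.add_sub_cancel' h]
    rw [Finset.sum_eq_single i, if_pos ⟨hi, rfl⟩]
    · intro j _ hj
      rw [if_neg]
      rintro ⟨h, -⟩
      have h1 : m + (i : ℕ) ≡ m + j [MOD m + 1] := hi.symm.trans h
      have h2 := Nat.ModEq.add_left_cancel' m h1
      have h3 := Nat.ModEq.eq_of_lt_of_lt h2 i.2 j.2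
      exact hj (Fin.ext h3.symm)
    · exact fun h => absurd (Finset.mem_univ _) h
  · rw [Matrix.one_apply_ne hab.symm]
    exact Finset.sum_eq_zero fun i _ => if_neg fun h => hab h.2

theorem exists_surjective (S : Type*) [AddCommGroup S] [Module R S] [IsSimpleModule R S] :
    ∃ i : Fin (m + 1), ∃ f : D.F ((vertex i : Fin (2 * m + 1)) + 1) →ₗ[R] S,
      Function.Surjective f := by
  have := IsSimpleModule.nontrivial R S
  obtain ⟨s, hs⟩ := exists_ne (0 : S)
  obtain ⟨i, hi⟩ : ∃ i, D.idem (vertex i) • s ≠ 0 := by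
    by_contra! h
    apply hs
    rw [← one_smul R s, ← D.sum_idem, Finset.sum_smul]
    exact Finset.sum_eq_zero fun i _ => h i
  obtain ⟨f, hf⟩ := exists_linearMap_apply_eq_smul (D.exists_smul_single (vertex i))
    (D.mul_idem_eq_zero (le_vertex i)) s
  refine ⟨i, f, (LinearMap.surjective_or_eq_zero f).resolve_right fun h => hi ?_⟩
  rw [← hf, h, LinearMap.zero_apply]

theorem indecomposableProjectivesUniserial (D : ShiftModel K m R) [IsArtinianRing R] :
    IndecomposableProjectivesUniserial R := by
  have : ∀ i : Fin (m + 1), Module.Projective R (D.F ((vertex i : Fin (2 * m + 1)) + 1)) :=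
    fun i => D.projective_F (le_vertex i)
  exact indecomposableProjectivesUniserial_of_family
    (fun i : Fin (m + 1) => D.F ((vertex i : Fin (2 * m + 1)) + 1)) (fun i => D.isUniserial_F _)
    fun S _ _ _ => D.exists_surjective S

theorem nontrivial_F (y : Fin (2 * m + 1)) : Nontrivial (D.F (y + 1)) :=
  ⟨D.single y, 0, fun h => one_ne_zero (α := K) (by
    rw [← D.single_apply_self y, h]
    rfl)⟩

/-- A vector with nonzero coordinate at `y` generates `F (y + 1)`, so it cannot lie in the radical;
conversely `F y` is a proper submodule of a uniserial module. -/
theorem radPow_one_F [IsArtinianRing R] (y : Fin (2 * m + 1)) :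
    radPow R (D.F (y + 1)) 1 = (D.F y).comap (D.F (y + 1)).subtype := by
  have := D.nontrivial_F y
  apply le_antisymm
  · intro v hv x hx
    by_contra hne
    have hxy : x = y := by
      by_contra hxy
      have h1 : (y : ℕ) < x := lt_of_le_of_ne hx fun h => hxy (Fin.ext h.symm)
      exact hne (v.2 x h1)
    subst hxy
    refine radPow_one_ne_top (R := R) (M := D.F (x + 1)) (eq_top_iff.2 fun w _ => ?_)
    obtain ⟨r, hr⟩ := D.exists_smul_eq v.2 hne w.2
    rw [show w = r • v from Subtype.ext hr.symm]
    exact Submodule.smul_mem _ _ hv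
  · refine (D.isUniserial_F _).le_radPow_one fun h => ?_
    have h1 : (D.single y).1 ∈ D.F y := (h.ge : ⊤ ≤ _) (Submodule.mem_top (x := D.single y))
    exact one_ne_zero (α := K) (by rw [← D.single_apply_self y]; exact h1 y le_rfl)

theorem jacobson_smul_F [IsArtinianRing R] (y : Fin (2 * m + 1)) :
    Ring.jacobson R ^ 1 • D.F (y + 1) = D.F y := by
  have h := map_jacobson_pow_smul (D.F (y + 1)).subtype 1
  rw [radPow_one_F, Submodule.range_subtype, Submodule.map_comap_subtype,
    inf_eq_right.2 (D.F_mono (Nat.le_succ _))] at h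
  exact h.symm

theorem radPow_col [IsArtinianRing R] (k : ℕ) (hk : k ≤ 2 * m + 1) :
    radPow R D.Col k = D.F (2 * m + 1 - k) := by
  induction k with
  | zero => rw [radPow_zero, Nat.sub_zero, F_top]
  | succ k ih =>
    rw [Nat.add_comm k 1, ← jacobson_pow_smul_radPow, ih (by omega)]
    have := D.jacobson_smul_F ⟨2 * m - k, by omega⟩
    rw [show 2 * m + 1 - k = 2 * m - k + 1 by omega, show 2 * m + 1 - (1 + k) = 2 * m - k by omega]
    exact this

/-- The column module is faithful, so a power of the Jacobson radical vanishes exactly when it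
annihilates the columns, whose radical series drops one coordinate at a time. -/
theorem radLength_eq (D : ShiftModel K m R) [IsArtinianRing R] : radLength R R = 2 * m + 1 := by
  have key : ∀ k, radPow R R k = ⊥ ↔ radPow R D.Col k = ⊥ := by
    intro k
    constructor
    · intro h
      have h1 : Ring.jacobson R ^ k = ⊥ := by
        rw [eq_bot_iff, ← h]
        intro r hr
        rw [← mul_one r]
        exact Submodule.smul_mem_smul hr trivial
      rw [radPow, h1, Submodule.bot_smul]
    · intro h
      rw [eq_bot_iff, radPow, Submodule.smul_le]
      intro r hr s _
      have h1 : r = 0 := by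
        apply D.injective
        rw [map_zero]
        ext x y
        rw [← D.smul_single_apply, Matrix.zero_apply]
        have h2 : r • (D.single y).1 ∈ radPow R D.Col k := Submodule.smul_mem_smul hr trivial
        rw [h, Submodule.mem_bot] at h2
        exact congrFun h2 x
      rw [h1, zero_smul]
      exact zero_mem _
  apply le_antisymm
  · rw [← radPow_eq_bot_iff, key, D.radPow_col _ le_rfl, Nat.sub_self, F_zero]
  · by_contra hlt
    have h1 : radPow R R (2 * m) = ⊥ := radPow_eq_bot_iff.2 (by omega)
    rw [key, D.radPow_col _ (by omega), show 2 * m + 1 - 2 * m = 0 + 1 by omega] at h1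
    have h2 := (D.single 0).2
    have h3 : (D.single 0).1 = 0 := by
      rw [← Submodule.mem_bot R, ← h1]
      exact h2
    exact one_ne_zero (α := K) (by rw [← D.single_apply_self 0, h3]; rfl)

/-- The underlying function of `ShiftModel.shift`. -/
def shiftFun (v : D.Col) : D.Col :=
  fun x => if h : (x : ℕ) < m then v ⟨x + (m + 1), by omega⟩ else 0

theorem shiftFun_apply (v : D.Col) (x : Fin (2 * m + 1)) :
    D.shiftFun v x = if h : (x : ℕ) < m then v ⟨x + (m + 1), by omega⟩ else 0 := rfl

/-- The shift by `m + 1` coordinates. -/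
def shift : D.Col →ₗ[R] D.Col where
  toFun := D.shiftFun
  map_add' v w := by
    funext x
    rw [D.add_apply, shiftFun_apply, shiftFun_apply, shiftFun_apply]
    split_ifs
    · rfl
    · exact (add_zero _).symm
  map_smul' r v := by
    funext x
    rw [RingHom.id_apply, D.smul_apply, shiftFun_apply]
    simp only [shiftFun_apply]
    split_ifs with hx
    · rw [D.smul_apply]
      symm
      refine Finset.sum_bij_ne_zero (fun z _ hz => ⟨z + (m + 1), ?_⟩) ?_ ?_ ?_ ?_
      · by_contra h
        rw [dif_neg (by omega), mul_zero] at hz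
        exact hz rfl
      · exact fun _ _ _ => Finset.mem_univ _
      · intro z _ _ z' _ _ h
        simpa [Fin.ext_iff] using h
      · intro z _ hz
        have hzx : ⟨x + (m + 1), by omega⟩ ≤ z := not_lt.1 fun h => hz (by
          rw [(D.mem r).1 _ z h, zero_mul])
        have hzx' : (x : ℕ) + (m + 1) ≤ z := hzx
        have h1 : (z : ℕ) = (z - (m + 1) : ℕ) + (m + 1) := by omega
        have h2 : (⟨(z - (m + 1) : ℕ) + (m + 1), by omega⟩ : Fin (2 * m + 1)) = z :=
          Fin.ext h1.symm
        refine ⟨⟨z - (m + 1), by omega⟩, Finset.mem_univ _, ?_, h2⟩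
        rw [dif_pos (show (z - (m + 1) : ℕ) < m by omega),
          ← (D.mem r).2 x ⟨z - (m + 1), by omega⟩ ⟨x + (m + 1), by omega⟩ z rfl h1]
        simp only [h2]
        exact hz
      · intro z _ hz
        have hzm : (z : ℕ) < m := by
          by_contra h
          rw [dif_neg h, mul_zero] at hz
          exact hz rfl
        rw [(D.mem r).2 x z ⟨x + (m + 1), by omega⟩ ⟨z + (m + 1), by omega⟩ rfl rfl]
        exact congrArg (D.ρ r x z * ·) (dif_pos hzm)
    · symm
      refine Finset.sum_eq_zero fun z _ => ?_
      rcases lt_or_ge z x with hz | hz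
      · rw [(D.mem r).1 _ z hz, zero_mul]
      · have hz' : (x : ℕ) ≤ z := hz
        rw [dif_neg (by omega), mul_zero]

theorem shift_apply (v : D.Col) (x : Fin (2 * m + 1)) :
    D.shift v x = if h : (x : ℕ) < m then v ⟨x + (m + 1), by omega⟩ else 0 := rfl

theorem ker_shift : LinearMap.ker D.shift = D.F (m + 1) := by
  refine Submodule.ext fun v => ?_
  rw [LinearMap.mem_ker, mem_F]
  constructor
  · intro h x hx
    have h1 := congrFun h ⟨x - (m + 1), by omega⟩
    rw [shift_apply, dif_pos (show (x - (m + 1) : ℕ) < m by omega)] at h1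
    have h2 : (⟨(x - (m + 1) : ℕ) + (m + 1), by omega⟩ : Fin (2 * m + 1)) = x :=
      Fin.ext (by simp only; omega)
    simp only [h2] at h1
    exact h1
  · intro h
    funext x
    rw [shift_apply]
    split_ifs with hx
    · exact h _ (by simp only; omega)
    · rfl

theorem range_shift : LinearMap.range D.shift = D.F m := by
  refine Submodule.ext fun v => ?_
  rw [LinearMap.mem_range, mem_F]
  constructor
  · rintro ⟨w, rfl⟩ x hx
    rw [shift_apply, dif_neg (not_lt.2 hx)]
  · intro h
    let w : D.Col := fun x => if hx : m + 1 ≤ (x : ℕ) then v ⟨x - (m + 1), by omega⟩ else 0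
    have hw : ∀ x, w x = if hx : m + 1 ≤ (x : ℕ) then v ⟨x - (m + 1), by omega⟩ else 0 :=
      fun _ => rfl
    refine ⟨w, ?_⟩
    funext x
    rw [shift_apply]
    split_ifs with hx
    · rw [hw, dif_pos (by simp only; omega)]
      congr 1
      exact Fin.ext (by simp only; omega)
    · exact (h x (by omega)).symm

/-- For `y > m` the module is itself projective. For `y = m` the shift gives the resolution `0 → F
(m + 1) → Col → F m → 0`. -/
theorem hasProjectiveDimensionLT_F (y : Fin (2 * m + 1)) (hy : m ≤ y) :
    HasProjectiveDimensionLT (ModuleCat.of R (D.F y)) 2 := by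
  rcases hy.eq_or_lt with h | h
  · rw [← h]
    have hcol : Module.Projective R D.Col := by
      have := D.projective_F (y := ⟨2 * m, by omega⟩) (by simp only; omega)
      have h2 : D.F ((⟨2 * m, by omega⟩ : Fin (2 * m + 1)) + 1) = ⊤ := D.F_top
      rw [h2] at this
      exact Module.Projective.of_equiv Submodule.topEquiv
    have hker : Module.Projective R (D.F (m + 1)) :=
      D.projective_F (y := ⟨m, by omega⟩) le_rfl
    have hS := shortExact_moduleCatMk (D.F (m + 1)).subtype
      (D.shift.codRestrict (D.F m) fun v => D.range_shift.le (LinearMap.mem_range_self _ v))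
      Subtype.val_injective
      (by
        rw [← LinearMap.range_eq_top, LinearMap.range_codRestrict, D.range_shift,
          Submodule.comap_subtype_self])
      (by rw [Submodule.range_subtype, LinearMap.ker_codRestrict, D.ker_shift])
    exact (hS.hasProjectiveDimensionLT_X₃_iff 0 ((IsProjective.iff_projective D.Col).1 hcol)).2
      (projective_iff_hasProjectiveDimensionLT_one.1
        ((IsProjective.iff_projective (D.F (m + 1))).1 hker))
  · have hp := D.projective_F (y := ⟨y - 1, by omega⟩) (by simp only; omega)
    have h1 : ((⟨y - 1, by omega⟩ : Fin (2 * m + 1)) : ℕ) + 1 = y := by simp only; omega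
    rw [h1] at hp
    have := projective_iff_hasProjectiveDimensionLT_one.1
      ((IsProjective.iff_projective (D.F y)).1 hp)
    exact hasProjectiveDimensionLT_of_ge _ 1 2 (by omega)

theorem hasFiniteGlobalDimension (D : ShiftModel K m R) [IsArtinianRing R] : HasFiniteGlobalDimension R := by
  refine ⟨2, hasProjectiveDimensionLT_of_simples 2 fun S _ _ _ => ?_⟩
  obtain ⟨i, f, hf⟩ := D.exists_surjective S
  have hker := ((D.isUniserial_F _).ker_eq_radPow_one hf).trans (D.radPow_one_F _)
  have hle : D.F (vertex i : Fin (2 * m + 1)) ≤ D.F ((vertex i : Fin (2 * m + 1)) + 1) :=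
    D.F_mono (Nat.le_succ _)
  have hS := shortExact_moduleCatMk (Submodule.inclusion hle) f
    (Submodule.inclusion_injective hle) hf (by rw [hker, Submodule.range_inclusion])
  have hp := D.projective_F (le_vertex i)
  exact (hS.hasProjectiveDimensionLT_X₃_iff 1 ((IsProjective.iff_projective _).1 hp)).2
    (D.hasProjectiveDimensionLT_F _ (le_vertex i))

/-- The simple modules are the tops of the `m + 1` projectives. They are pairwise non-isomorphic
because the idempotent at a vertex fixes the generator of its own top and annihilates the others. -/
theorem numSimples_eq (D : ShiftModel K m R) [IsArtinianRing R] : numSimples R = m + 1 := by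
  have hne := fun i : Fin (m + 1) => D.nontrivial_F (vertex i)
  let T : Fin (m + 1) → {S : ModuleCat.{v} R // IsSimpleModule R S} := fun i =>
    ⟨ModuleCat.of R (D.F ((vertex i : Fin (2 * m + 1)) + 1) ⧸
      radPow R (D.F ((vertex i : Fin (2 * m + 1)) + 1)) 1), (D.isUniserial_F _).isSimpleModule_top⟩
  have hbij : Function.Bijective fun i => (⟦T i⟧ : Quotient (simpleModuleSetoid R)) := by
    constructor
    · intro i j hij
      obtain ⟨e⟩ : Nonempty ((T i).1 ≃ₗ[R] (T j).1) := Quotient.exact hij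
      by_contra hne
      let x : (T i).1 := Submodule.Quotient.mk (D.single (vertex i))
      have h1 : D.idem (vertex i) • x = x :=
        congrArg Submodule.Quotient.mk (D.idem_smul_single (vertex i))
      have h2 : ∀ z : (T j).1, D.idem (vertex i) • z = 0 := by
        intro z
        obtain ⟨w, rfl⟩ := Submodule.mkQ_surjective _ z
        rw [← map_smul, Submodule.mkQ_apply, Submodule.Quotient.mk_eq_zero, D.radPow_one_F]
        intro a ha
        rcases ha.eq_or_lt with h | h
        · have ha' : a = vertex j := Fin.ext h.symm
          rw [ha']
          refine (D.smul_apply_of_mem_F w.2 _).trans ?_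
          rw [ρ_idem, if_neg, zero_mul]
          rintro ⟨h3, -⟩
          have h4 := Nat.ModEq.add_left_cancel' m h3
          exact hne (Fin.ext (Nat.ModEq.eq_of_lt_of_lt h4 j.2 i.2).symm)
        · exact (D.idem (vertex i) • w).2 a h
      have h3 : x = 0 := by
        apply e.injective
        rw [map_zero, ← h1, map_smul, h2]
      have h4 := (Submodule.Quotient.mk_eq_zero _).1 h3
      rw [D.radPow_one_F] at h4
      have h5 : (D.single (vertex i)).1 (vertex i) = 0 := h4 (vertex i) le_rfl
      rw [D.single_apply_self] at h5
      exact one_ne_zero h5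
    · intro q
      induction q using Quotient.inductionOn with
      | h S =>
      have := S.2
      obtain ⟨i, f, hf⟩ := D.exists_surjective S.1
      have := IsSimpleModule.nontrivial R S.1
      have := (T i).2
      exact ⟨i, Quotient.sound (nonempty_equiv_of_common_quotient (S₁ := (T i).1)
        (D.isUniserial_F _) (D.isUniserial_F _) (Submodule.mkQ_surjective _) hf hf hf)⟩
  rw [numSimples, ← Nat.card_eq_of_bijective _ hbij, Nat.card_fin]

end ShiftModel

/-! ### The example and its opposite as shift models -/

section Models

variable (K : Type v) [Field K] (m : ℕ)

/-- The identity of `shiftAlgebra K m`. -/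
def shiftModel : ShiftModel K m (shiftAlgebra K m) where
  ρ := (shiftAlgebra K m).val
  injective := Subtype.val_injective
  mem r := r.2
  surj a ha := ⟨⟨a, ha⟩, rfl⟩

theorem transpose_submatrix_rev_mem {K : Type v} [Field K] {m : ℕ}
    {a : Matrix (Fin (2 * m + 1)) (Fin (2 * m + 1)) K} (ha : a ∈ shiftAlgebra K m) :
    a.transpose.submatrix Fin.rev Fin.rev ∈ shiftAlgebra K m := by
  refine ⟨fun x y hxy => ha.1 _ _ (Fin.rev_lt_rev.2 hxy), fun x y x' y' hx hy => ?_⟩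
  refine (ha.2 y'.rev x'.rev y.rev x.rev ?_ ?_).symm
  · rw [Fin.val_rev, Fin.val_rev]
    omega
  · rw [Fin.val_rev, Fin.val_rev]
    omega

theorem submatrix_rev_transpose_submatrix_rev {K : Type v} {n : ℕ} (a : Matrix (Fin n) (Fin n) K) :
    (a.transpose.submatrix Fin.rev Fin.rev).transpose.submatrix Fin.rev Fin.rev = a := by
  ext x y
  simp only [Matrix.submatrix_apply, Matrix.transpose_apply, Fin.rev_rev]

/-- The opposite algebra of `shiftAlgebra K m` is isomorphic to it by reflection at the
antidiagonal. -/
def shiftModelOp : ShiftModel K m (shiftAlgebra K m)ᵐᵒᵖ where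
  ρ :=
    { toFun := fun a => a.unop.1.transpose.submatrix Fin.rev Fin.rev
      map_one' := by
        change (1 : Matrix (Fin (2 * m + 1)) (Fin (2 * m + 1)) K).transpose.submatrix _ _ = 1
        rw [Matrix.transpose_one, Matrix.submatrix_one _ Fin.rev_injective]
      map_mul' := fun a b => by
        change (b.unop.1 * a.unop.1).transpose.submatrix _ _ = _
        rw [Matrix.transpose_mul]
        exact (Matrix.submatrix_mul_equiv _ _ _ Fin.revPerm _).symm
      map_zero' := rfl
      map_add' := fun _ _ => rfl }
  injective a b h := by
    apply MulOpposite.unop_injective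
    apply Subtype.ext
    rw [← submatrix_rev_transpose_submatrix_rev a.unop.1,
      ← submatrix_rev_transpose_submatrix_rev b.unop.1]
    exact congrArg (fun c => c.transpose.submatrix Fin.rev Fin.rev) h
  mem a := transpose_submatrix_rev_mem a.unop.2
  surj a ha := ⟨MulOpposite.op ⟨_, transpose_submatrix_rev_mem ha⟩,
    submatrix_rev_transpose_submatrix_rev a⟩

end Models

/-! ### Loewy length for right modules, and the main theorem -/

theorem loewyLength_eq_radLength (R : Type u) (M : Type v) [Ring R] [IsSemiprimaryRing R]
    [AddCommGroup M] [Module R M] : loewyLength R M = radLength R M := by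
  have h : {k : ℕ | Ring.jacobson R ^ k • (⊤ : Submodule R M) = ⊥} = Set.Ici (radLength R M) :=
    Set.ext fun k => radPow_eq_bot_iff
  rw [loewyLength, h, csInf_Ici]

theorem radLength_eq_of_equiv {R M M' : Type*} [Ring R] [IsSemiprimaryRing R] [AddCommGroup M]
    [Module R M] [AddCommGroup M'] [Module R M'] (e : M ≃ₗ[R] M') :
    radLength R M = radLength R M' := by
  refine le_antisymm ?_ ?_
  · rw [← radPow_eq_bot_iff, ← map_radPow_of_surjective (f := e.symm.toLinearMap) e.symm.surjective,
      radPow_eq_bot_iff.2 le_rfl, Submodule.map_bot]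
  · rw [← radPow_eq_bot_iff, ← map_radPow_of_surjective (f := e.toLinearMap) e.surjective,
      radPow_eq_bot_iff.2 le_rfl, Submodule.map_bot]

/-- A ring, as a right module over itself, is the left regular module of the opposite ring. -/
def opLinearEquivSelf (A : Type*) [Ring A] : A ≃ₗ[Aᵐᵒᵖ] Aᵐᵒᵖ where
  toFun := MulOpposite.op
  invFun := MulOpposite.unop
  map_add' _ _ := rfl
  map_smul' _ _ := rfl
  left_inv _ := rfl
  right_inv _ := rfl

theorem loewyLength_op (A : Type*) [Ring A] [IsSemiprimaryRing Aᵐᵒᵖ] :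
    loewyLength Aᵐᵒᵖ A = radLength Aᵐᵒᵖ Aᵐᵒᵖ := by
  rw [loewyLength_eq_radLength, radLength_eq_of_equiv (opLinearEquivSelf A)]

theorem proposition1p8 {K : Type v} [Field K] :
    -- the two assertions on a nonzero Nakayama algebra `A`; modules are right modules
    (∀ (A : Type u) [Ring A] [Algebra K A] [Nontrivial A], IsNakayamaAlgebra K A →
      (2 * numSimples Aᵐᵒᵖ ≤ loewyLength Aᵐᵒᵖ A →
        ∃ M : ModuleCat.{u} Aᵐᵒᵖ, Module.Finite Aᵐᵒᵖ M ∧ Indecomposable M ∧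
          ∀ i : ℕ, 0 < i → Nontrivial (Abelian.Ext M M i)) ∧
      (HasFiniteGlobalDimension Aᵐᵒᵖ →
        (loewyLength Aᵐᵒᵖ A : ℤ) ≤ 2 * (numSimples Aᵐᵒᵖ : ℤ) - 1)) ∧
    -- the bound is attained, over every field and for every number of simple modules
    (∀ n : ℕ, 1 ≤ n → ∃ (A : Type v) (_ : Ring A) (_ : Algebra K A),
      IsNakayamaAlgebra K A ∧ numSimples Aᵐᵒᵖ = n ∧ HasFiniteGlobalDimension Aᵐᵒᵖ ∧
        (loewyLength Aᵐᵒᵖ A : ℤ) = 2 * (n : ℤ) - 1) := by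
  refine ⟨fun A _ _ _ hA => ?_, fun n hn => ?_⟩
  · have := hA.finiteDimensional
    have : IsArtinianRing Aᵐᵒᵖ := IsArtinianRing.of_finite K Aᵐᵒᵖ
    have key : 2 * numSimples Aᵐᵒᵖ ≤ loewyLength Aᵐᵒᵖ A →
        ∃ M : ModuleCat.{u} Aᵐᵒᵖ, Module.Finite Aᵐᵒᵖ M ∧ Indecomposable M ∧
          ∀ i : ℕ, 0 < i → Nontrivial (Abelian.Ext M M i) := fun h =>
      exists_nontrivial_ext_self hA.right (by rwa [← loewyLength_op])
    refine ⟨key, fun ⟨d, hd⟩ => ?_⟩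
    by_contra hlt
    obtain ⟨M, -, -, hM⟩ := key (by omega)
    have := hd M
    -- A bound `d` on projective dimensions makes `Ext^(d + 1)(M, M)` vanish, against the choice of
    -- `M`.
    have h1 := HasProjectiveDimensionLT.subsingleton M (d + 1) (d + 1) le_rfl M
    exact not_nontrivial_iff_subsingleton.2 h1 (hM (d + 1) d.succ_pos)
  · obtain ⟨m, rfl⟩ : ∃ m, n = m + 1 := ⟨n - 1, by omega⟩
    have : IsArtinianRing (shiftAlgebra K m) := IsArtinianRing.of_finite K _
    have : IsArtinianRing (shiftAlgebra K m)ᵐᵒᵖ := IsArtinianRing.of_finite K _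
    refine ⟨shiftAlgebra K m, inferInstance, inferInstance,
      ⟨inferInstance, (shiftModel K m).indecomposableProjectivesUniserial,
        (shiftModelOp K m).indecomposableProjectivesUniserial⟩,
      (shiftModelOp K m).numSimples_eq, (shiftModelOp K m).hasFiniteGlobalDimension, ?_⟩
    rw [loewyLength_op, (shiftModelOp K m).radLength_eq]
    push_cast
    ring
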